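/- Let $S^1=\mathbb R/\mathbb Z$, $\mathbb T^2=S^1\times S^1$, and let $\mathrm{Homeo}_+(S^1)$ be the orientation-preserving homeomorphisms of $S^1$ with the topology of uniform convergence. Let $g_1,g_2\in\mathrm{Homeo}_+(S^1)$ be Denjoy counterexamples: $g_i$ has irrational rotation number $\rho_i$ and a minimal set $M_i\subsetneq S^1$. Assume that $1,\rho_1,\rho_2$ are rationally independent. Let $\mathcal B$ be the space, with the uniform topology, of continuous maps $\beta:S^1\to\mathrm{Homeo}_+(S^1)$ such that $\beta(s)=g_2$ for all $s\in M_1$, and for $\beta\in\mathcal B$ let $f_\beta:\mathbb T^2\to\mathbb T^2$ be the homeomorphism $f_\beta(s,t)=(g_1(s),\beta(s)(t))$. A homeomorphism $f$ of $\mathbb T^2$ is called non-resonant if it is homotopic to the identity and its rotation set (the set of limits of sequences $(F^{n_i}(z_i)-z_i)/n_i$ with $n_i\to\infty$ and $z_i\in\mathbb R^2$, for a lift $F$ of $f$ to $\mathbb R^2$) is a single vector $(a,b)$ with $1,a,b$ rationally independent. Let $\Omega(f)$ be the set of points $x$ such that for every neighbourhood $U$ of $x$ there is $n>0$ with $f^n(U)\cap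 U\neq\emptyset$. Then: 1. For every $\beta\in\mathcal B$, the set $M_1\times M_2$ is the unique minimal set of $f_\beta$. 2. For every $\beta\in\mathcal B$ which is homotopic within $\mathcal B$ (that is, relative to $M_1$) to the constant map $s\mapsto g_2$, $f_\beta$ is non-resonant, with rotation vector $(\rho_1,\rho_2)$ modulo $\mathbb Z^2$. 3. There is a dense $G_\delta$ subset $\mathcal R\subset\mathcal B$ such that for every $\beta\in\mathcal R$ one has $\Omega(f_\beta)=M_1\times S^1$, and $f_\beta|_{\Omega(f_\beta)}$ is not transitive (transitive on $K$ meaning that for any two nonempty relatively open $U,V\subset K$ there is $n>0$ with $f^n(U)\cap V\neq\emptyset$). 4. In particular, there is $\beta\in\mathcal B$ such that $f_\beta$ is non-resonant, $\Omega(f_\beta)=M_1\times S^1$, and $f_\beta|_{\Omega(f_\beta)}$ is not transitive. -/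

import Mathlib

open Set Filter Topology

namespace DenjoySkew

/-! ### Dynamics of a homeomorphism -/

section Dynamics

variable {X : Type*} [TopologicalSpace X]

/-- The nonwandering set `Ω(f)`: points all of whose neighbourhoods `U` satisfy
`f^n(U) ∩ U ≠ ∅` for some `n > 0`. -/
def nonwanderingSet (f : X ≃ₜ X) : Set X :=
  {x | ∀ U ∈ 𝓝 x, ∃ n : ℕ, 0 < n ∧ ((f^[n] '' U) ∩ U).Nonempty}

/-- `M` is a minimal set of `f`: a nonempty compact invariant set with no nonempty compact
invariant subset other than itself. -/
structure IsMinimalSet (f : X ≃ₜ X) (M : Set X) : Prop where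
  nonempty : M.Nonempty
  isCompact : IsCompact M
  invariant : f '' M = M
  minimal : ∀ K : Set X, K ⊆ M → K.Nonempty → IsCompact K → f '' K = K → K = M

/-- The restriction `f|_K` is transitive: for all open `U`, `V` which meet `K` there is `n > 0`
with `f^n(U ∩ K) ∩ (V ∩ K) ≠ ∅` (`U ∩ K` and `V ∩ K` are the nonempty relatively open
subsets of `K`). -/
def IsTransitiveOn (f : X ≃ₜ X) (K : Set X) : Prop :=
  ∀ U V : Set X, IsOpen U → IsOpen V → (U ∩ K).Nonempty → (V ∩ K).Nonempty →
    ∃ n : ℕ, 0 < n ∧ ((f^[n] '' (U ∩ K)) ∩ (V ∩ K)).Nonempty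

end Dynamics

/-! ### Circle homeomorphisms -/

/-- `G : ℝ → ℝ`, a monotone map with `G (x + 1) = G x + 1`, is a continuous lift of `g`. -/
def IsCircleLift (G : CircleDeg1Lift) (g : UnitAddCircle ≃ₜ UnitAddCircle) : Prop :=
  Continuous G ∧ ∀ x : ℝ, ((G x : ℝ) : UnitAddCircle) = g (x : UnitAddCircle)

/-- `Homeo₊(S¹)`, the orientation preserving homeomorphisms of the circle `S¹ = ℝ/ℤ`. -/
structure HomeoPlus where
  toHomeo : UnitAddCircle ≃ₜ UnitAddCircle
  exists_lift : ∃ G : CircleDeg1Lift, IsCircleLift G toHomeo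

/-- The underlying continuous map of an element of `Homeo₊(S¹)`. -/
def HomeoPlus.toMap (g : HomeoPlus) : C(UnitAddCircle, UnitAddCircle) :=
  ⟨g.toHomeo, g.toHomeo.continuous⟩

/-- The topology of uniform convergence (the compact-open topology) on `Homeo₊(S¹)`. -/
instance : TopologicalSpace HomeoPlus :=
  TopologicalSpace.induced HomeoPlus.toMap inferInstance

/-- `ρ : ℝ` represents, modulo `ℤ`, the rotation number of `g`. -/
def HasRotationNumber (g : HomeoPlus) (ρ : ℝ) : Prop :=
  ∃ G : CircleDeg1Lift, IsCircleLift G g.toHomeo ∧ G.translationNumber = ρ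

/-- `g` is a Denjoy counterexample with rotation number `ρ` (mod `ℤ`) and minimal set `M`: an
orientation preserving circle homeomorphism with irrational rotation number and with a minimal
set which is not the whole circle. -/
structure IsDenjoyCounterexample (g : HomeoPlus) (ρ : ℝ) (M : Set UnitAddCircle) : Prop where
  hasRotationNumber : HasRotationNumber g ρ
  irrational : Irrational ρ
  isMinimalSet : IsMinimalSet g.toHomeo M
  ne_univ : M ≠ univ

/-! ### Torus homeomorphisms -/

/-- The torus `𝕋² = S¹ × S¹`. -/
abbrev Torus : Type := UnitAddCircle × UnitAddCircle

/-- `f ∈ Homeo₀(𝕋²)`: the homeomorphism `f` is homotopic to the identity. -/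
def IsHomotopicToId (f : Torus ≃ₜ Torus) : Prop :=
  ContinuousMap.Homotopic (⟨f, f.continuous⟩ : C(Torus, Torus)) (ContinuousMap.id Torus)

/-- `F` is a lift of `f` to the universal cover `ℝ²` of the torus. -/
def IsTorusLift (F : ℝ × ℝ → ℝ × ℝ) (f : Torus ≃ₜ Torus) : Prop :=
  Continuous F ∧ ∀ z : ℝ × ℝ,
    (((F z).1 : UnitAddCircle), ((F z).2 : UnitAddCircle)) =
      f ((z.1 : UnitAddCircle), (z.2 : UnitAddCircle))

/-- The rotation set of a lift `F`: all limits of sequences `(F^{n_i}(z_i) - z_i) / n_i` with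
`n_i → ∞`. -/
def rotationSet (F : ℝ × ℝ → ℝ × ℝ) : Set (ℝ × ℝ) :=
  {v | ∃ (n : ℕ → ℕ) (z : ℕ → ℝ × ℝ), Tendsto n atTop atTop ∧
    Tendsto (fun i => (n i : ℝ)⁻¹ • (F^[n i] (z i) - z i)) atTop (𝓝 v)}

/-- The rotation set of `f` is, modulo `ℤ²`, the single vector `v`. -/
def HasUniqueRotationVector (f : Torus ≃ₜ Torus) (v : ℝ × ℝ) : Prop :=
  ∃ F : ℝ × ℝ → ℝ × ℝ, IsTorusLift F f ∧ rotationSet F = {v}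

/-- `f` is non-resonant: it is homotopic to the identity and its rotation set is a single vector
`(α, β)` with `1, α, β` rationally independent. -/
def IsNonResonant (f : Torus ≃ₜ Torus) : Prop :=
  IsHomotopicToId f ∧ ∃ v : ℝ × ℝ, HasUniqueRotationVector f v ∧
    LinearIndependent ℚ ![(1 : ℝ), v.1, v.2]

/-! ### Skew products -/

theorem continuous_skew (g : HomeoPlus) (β : C(UnitAddCircle, HomeoPlus)) :
    Continuous (fun p : Torus => (g.toHomeo p.1, (β p.1).toHomeo p.2)) := by
  have h1 : Continuous (fun p : Torus => (β p.1).toMap) :=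
    continuous_induced_dom.comp (β.continuous.comp continuous_fst)
  have h2 : Continuous (fun p : Torus => (β p.1).toMap p.2) := h1.eval continuous_snd
  exact (g.toHomeo.continuous.comp continuous_fst).prodMk h2

/-- The skew product `f_β(s,t) = (g(s), β(s)(t))` as a bijection of the torus. -/
def skewEquiv (g : HomeoPlus) (β : C(UnitAddCircle, HomeoPlus)) : Torus ≃ Torus where
  toFun p := (g.toHomeo p.1, (β p.1).toHomeo p.2)
  invFun p := (g.toHomeo.symm p.1, (β (g.toHomeo.symm p.1)).toHomeo.symm p.2)
  left_inv p := by simp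
  right_inv p := by simp

/-- The skew product `f_β(s,t) = (g(s), β(s)(t))` as a homeomorphism of the torus. -/
def skew (g : HomeoPlus) (β : C(UnitAddCircle, HomeoPlus)) : Torus ≃ₜ Torus :=
  Continuous.homeoOfEquivCompactToT2 (f := skewEquiv g β) (continuous_skew g β)

theorem skew_apply (g : HomeoPlus) (β : C(UnitAddCircle, HomeoPlus)) (s t : UnitAddCircle) :
    skew g β (s, t) = (g.toHomeo s, (β s).toHomeo t) := rfl

/-- The space `𝓑` of continuous `β : S¹ → Homeo₊(S¹)` with `β(s) = g` for all `s ∈ M`, with the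
topology induced from the uniform (compact-open) topology on `C(S¹, Homeo₊(S¹))`. -/
abbrev FibreMaps (g : HomeoPlus) (M : Set UnitAddCircle) : Type :=
  {β : C(UnitAddCircle, HomeoPlus) // ∀ s ∈ M, β s = g}

end DenjoySkew

namespace DenjoySkew

/-! ### Density of irrational translations -/

/-! Each `gᵢ` has a lift `Gᵢ` and, by Poincaré, a continuous monotone degree one `Hᵢ` with `Hᵢ ∘ Gᵢ
= Hᵢ + ρᵢ`; `Mᵢ` is the projection of the set where `Hᵢ` is not locally constant
(`IsDenjoyCounterexample.exists_lift`). Hence every orbit accumulates on all of `Mᵢ`, while each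
point off `Mᵢ` has a wandering neighbourhood.

Minimal set: a compact invariant set of `f_β` has a point over `M₁`, where `f_β` is `g₁ × g₂`.
Kronecker's theorem, read through `H₁ × H₂`, makes its orbit accumulate on all of `M₁ × M₂`
(`prod_subset_of_invariant`).

Rotation vector: if `β` is homotopic to the constant map relative to `M₁`, or uniformly close to it,
then `β(s) - g₂` lifts to a real function vanishing over `M₁` (`IsDeviation`). It is small except
when the base orbit is in a compact set off `M₁`, which happens a bounded number of times, so it
contributes no drift (`rotationSet_skew_lift`).

Nonwandering set: wandering intervals in the base confine `Ω` to `M₁ × S¹`. For the converse, a base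
orbit off `M₁` eventually sees fibre maps close to `g₂`. A small rotation of the fibres along a long
finite piece of it, leaving `M₁` untouched, closes up the fibre coordinate, because the rotation
number strictly increases at an irrational value (`IsDenjoyLift.exists_drift_eq`,
`dense_returnSet`). Baire's theorem over a countable basis gives the residual set. Transitivity
fails on `M₁ × S¹` because `g₂` has wandering intervals. -/

theorem coe_eq_coe_iff {x y : ℝ} :
    (x : UnitAddCircle) = (y : UnitAddCircle) ↔ ∃ m : ℤ, x = y + m := by
  rw [← sub_eq_zero, ← AddCircle.coe_sub, AddCircle.coe_eq_zero_iff]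
  refine exists_congr fun m => ?_
  rw [zsmul_one]
  constructor <;> intro h <;> linarith

theorem coe_add_int (x : ℝ) (m : ℤ) : ((x + m : ℝ) : UnitAddCircle) = (x : UnitAddCircle) :=
  coe_eq_coe_iff.2 ⟨m, rfl⟩

theorem coe_sub_int (x : ℝ) (m : ℤ) : ((x - m : ℝ) : UnitAddCircle) = (x : UnitAddCircle) :=
  coe_eq_coe_iff.2 ⟨-m, by push_cast; ring⟩

theorem coe_surjective (s : UnitAddCircle) : ∃ x : ℝ, (x : UnitAddCircle) = s :=
  QuotientAddGroup.mk_surjective s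

theorem continuous_coe : Continuous (fun x : ℝ => (x : UnitAddCircle)) :=
  AddCircle.continuous_mk' 1

theorem isOpenMap_coe : IsOpenMap (fun x : ℝ => (x : UnitAddCircle)) :=
  QuotientAddGroup.isOpenMap_coe

theorem exists_add_mul_sub_int_mem_Ioo {ρ : ℝ} (hρ : Irrational ρ) (N : ℕ) (w : ℝ) {a b : ℝ}
    (hab : a < b) : ∃ k : ℕ, N ≤ k ∧ ∃ p : ℤ, w + k * ρ - p ∈ Ioo a b := by
  have hd : DenseRange (fun n : ℕ => n • (ρ : UnitAddCircle)) := by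
    rw [← denseRange_zsmul_iff_nsmul]
    exact AddCircle.denseRange_zsmul_coe_iff.2 (by simpa using hρ)
  -- Shifting the target by `N * ρ` as well turns a hit at time `n` into one at time `N + n`.
  obtain ⟨n, x, hx, hxn⟩ := hd.exists_mem_open
    (isOpenMap_coe _ (isOpen_Ioo (a := a - w - N * ρ) (b := b - w - N * ρ)))
    ((nonempty_Ioo.2 (by linarith)).image _)
  replace hxn : (x : UnitAddCircle) = ((n * ρ : ℝ) : UnitAddCircle) :=
    hxn.trans (by rw [← AddCircle.coe_nsmul, nsmul_eq_mul])
  obtain ⟨p, rfl⟩ := coe_eq_coe_iff.1 hxn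
  refine ⟨N + n, by omega, -p, ?_⟩
  have h1 := hx.1
  have h2 := hx.2
  constructor <;> push_cast <;> linarith

/-- Take `v` to be a limit direction of small elements `γ`: the multiple `⌊t / ‖γ‖⌋ • γ` differs
from `t • (γ / ‖γ‖)` by at most `‖γ‖`. -/
theorem exists_smul_mem_of_small {S : AddSubgroup (ℝ × ℝ)} (hS : IsClosed (S : Set (ℝ × ℝ)))
    (h : ∀ ε > 0, ∃ γ ∈ S, γ ≠ 0 ∧ ‖γ‖ < ε) : ∃ v : ℝ × ℝ, v ≠ 0 ∧ ∀ t : ℝ, t • v ∈ S := by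
  choose γ hγS hγ0 hγε using fun n : ℕ => h (1 / ((n : ℝ) + 1)) (by positivity)
  have hpos : ∀ n, 0 < ‖γ n‖ := fun n => norm_pos_iff.2 (hγ0 n)
  have hlim : Tendsto (fun n => ‖γ n‖) atTop (𝓝 0) :=
    squeeze_zero (fun _ => norm_nonneg _) (fun n => (hγε n).le) tendsto_one_div_add_atTop_nhds_zero_nat
  obtain ⟨v, hv, φ, hφ, hvlim⟩ := (isCompact_sphere (0 : ℝ × ℝ) 1).tendsto_subseq
    (x := fun n => ‖γ n‖⁻¹ • γ n) (fun n => by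
      simp [norm_smul, inv_mul_cancel₀ (hpos n).ne'])
  refine ⟨v, fun h0 => by simp [h0] at hv, fun t => ?_⟩
  have hlimφ := hlim.comp hφ.tendsto_atTop
  have key : Tendsto (fun n => ⌊t / ‖γ (φ n)‖⌋ • γ (φ n)) atTop (𝓝 (t • v)) := by
    have h1 : Tendsto (fun n => t • (‖γ (φ n)‖⁻¹ • γ (φ n)) -
        Int.fract (t / ‖γ (φ n)‖) • γ (φ n)) atTop (𝓝 (t • v - 0)) := by
      refine (hvlim.const_smul t).sub ?_
      refine squeeze_zero_norm (fun n => ?_) hlimφ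
      rw [norm_smul, Real.norm_eq_abs, abs_of_nonneg (Int.fract_nonneg _)]
      exact mul_le_of_le_one_left (norm_nonneg _) (Int.fract_lt_one _).le
    rw [sub_zero] at h1
    refine h1.congr fun n => ?_
    rw [smul_smul, ← sub_smul, ← div_eq_mul_inv, Int.self_sub_fract, Int.cast_smul_eq_zsmul]
  exact hS.mem_of_tendsto key (Eventually.of_forall fun n => S.zsmul_mem (hγS _) _)

/-- The linear form has kernel `ℝv ⊆ S`, so `S` is a union of its level lines, and densely many
levels occur. Moving `z` along the normal `(v.2, -v.1)` to such a level lands in `S`. -/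
theorem dense_of_line_subset {S : AddSubgroup (ℝ × ℝ)} (hS : IsClosed (S : Set (ℝ × ℝ)))
    {v : ℝ × ℝ} (hv : v ≠ 0) (hvS : ∀ t : ℝ, t • v ∈ S)
    (hL : Dense ((fun p : ℝ × ℝ => v.2 * p.1 - v.1 * p.2) '' S)) (z : ℝ × ℝ) : z ∈ S := by
  have hq : 0 < v.1 ^ 2 + v.2 ^ 2 := by
    by_contra hq
    have h1 : v.1 = 0 := by nlinarith [sq_nonneg v.1, sq_nonneg v.2]
    have h2 : v.2 = 0 := by nlinarith [sq_nonneg v.1, sq_nonneg v.2]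
    exact hv (Prod.ext h1 h2)
  set q := v.1 ^ 2 + v.2 ^ 2 with hqdef
  obtain ⟨c, hc, hclim⟩ := mem_closure_iff_seq_limit.1 (hL (v.2 * z.1 - v.1 * z.2))
  choose s hsS hs using hc
  have key : Tendsto (fun n => (z.1 - (v.2 * z.1 - v.1 * z.2 - c n) / q * v.2,
      z.2 + (v.2 * z.1 - v.1 * z.2 - c n) / q * v.1)) atTop (𝓝 (z.1 - 0 / q * v.2, z.2 + 0 / q * v.1)) := by
    have h0 : Tendsto (fun n => v.2 * z.1 - v.1 * z.2 - c n) atTop (𝓝 0) := by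
      simpa using hclim.const_sub (v.2 * z.1 - v.1 * z.2)
    exact (((h0.div_const q).mul_const v.2).const_sub z.1).prodMk_nhds
      (((h0.div_const q).mul_const v.1).const_add z.2)
  simp only [zero_div, zero_mul, sub_zero, add_zero] at key
  refine hS.mem_of_tendsto key (Eventually.of_forall fun n => ?_)
  have : (z.1 - (v.2 * z.1 - v.1 * z.2 - c n) / q * v.2,
      z.2 + (v.2 * z.1 - v.1 * z.2 - c n) / q * v.1) =
      s n + (((z.1 - (s n).1) * v.1 + (z.2 - (s n).2) * v.2) / q) • v := by
    rw [← hs n]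
    ext
    · simp only [Prod.fst_add, Prod.smul_fst, smul_eq_mul]
      field_simp
      rw [hqdef]; ring
    · simp only [Prod.snd_add, Prod.smul_snd, smul_eq_mul]
      field_simp
      rw [hqdef]; ring
  rw [this]
  exact S.add_mem (hsS n) (hvS _)

theorem eq_zero_of_int_relation {ρ₁ ρ₂ : ℝ} (hρ : LinearIndependent ℚ ![(1 : ℝ), ρ₁, ρ₂])
    {a b d : ℤ} (h : (d : ℝ) + a * ρ₁ + b * ρ₂ = 0) : a = 0 ∧ b = 0 := by
  have := Fintype.linearIndependent_iff.1 hρ ![(d : ℚ), a, b] (by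
    simp [Fin.sum_univ_three, Algebra.smul_def]; linarith)
  exact ⟨by simpa using this 1, by simpa using this 2⟩

/-- A subgroup of `ℝ` is dense or cyclic. If it were generated by `c`, the values at the three given
vectors would be `a * c`, `b * c`, `d * c` with `a * ρ₁ + b * ρ₂ = d`, forcing `a = b = 0` and `v =
0`. -/
theorem dense_image_of_mem {S : AddSubgroup (ℝ × ℝ)} {ρ₁ ρ₂ : ℝ}
    (hρ : LinearIndependent ℚ ![(1 : ℝ), ρ₁, ρ₂]) (h10 : (1, 0) ∈ S) (h01 : (0, 1) ∈ S)
    (hmem : (ρ₁, ρ₂) ∈ S) {v : ℝ × ℝ} (hv : v ≠ 0) :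
    Dense ((fun p : ℝ × ℝ => v.2 * p.1 - v.1 * p.2) '' S) := by
  let L : ℝ × ℝ →+ ℝ :=
    (AddMonoidHom.mulLeft v.2).comp (AddMonoidHom.fst ℝ ℝ) -
      (AddMonoidHom.mulLeft v.1).comp (AddMonoidHom.snd ℝ ℝ)
  have hL : ∀ p : ℝ × ℝ, L p = v.2 * p.1 - v.1 * p.2 := fun p => rfl
  have himg : ((fun p : ℝ × ℝ => v.2 * p.1 - v.1 * p.2) '' S) = (S.map L : Set ℝ) := rfl
  rw [himg]
  refine (AddSubgroup.dense_or_cyclic (S.map L)).resolve_right ?_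
  rintro ⟨c, hc⟩
  have hz : ∀ p ∈ S, ∃ k : ℤ, k * c = v.2 * p.1 - v.1 * p.2 := fun p hp => by
    have : L p ∈ S.map L := AddSubgroup.mem_map_of_mem L hp
    rw [hc, AddSubgroup.mem_closure_singleton] at this
    obtain ⟨k, hk⟩ := this
    exact ⟨k, by rw [← hL, ← hk, zsmul_eq_mul]⟩
  obtain ⟨a, ha⟩ := hz _ h10
  obtain ⟨b, hb⟩ := hz _ h01
  obtain ⟨d, hd⟩ := hz _ hmem
  simp only [mul_one, mul_zero, sub_zero, zero_sub] at ha hb hd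
  have hc0 : c ≠ 0 := by
    rintro rfl
    refine hv (Prod.ext ?_ ?_) <;> simp <;> linarith
  have hrel : ((-d : ℤ) : ℝ) + a * ρ₁ + b * ρ₂ = 0 := by
    apply mul_left_cancel₀ hc0
    push_cast
    linear_combination ρ₁ * ha + ρ₂ * hb - hd
  obtain ⟨rfl, rfl⟩ := eq_zero_of_int_relation hρ hrel
  refine hv (Prod.ext ?_ ?_)
  · simpa using hb.symm
  · simpa using ha.symm

theorem irrational_of_linearIndependent {ρ₁ ρ₂ : ℝ}
    (hρ : LinearIndependent ℚ ![(1 : ℝ), ρ₁, ρ₂]) {n : ℕ} (hn : n ≠ 0) (m : ℤ) :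
    (n : ℝ) * ρ₁ ≠ m := by
  intro h
  have := (eq_zero_of_int_relation hρ (a := n) (b := 0) (d := -m) (by push_cast; linarith)).1
  exact hn (by exact_mod_cast this)

theorem denseRange_nsmul_torus {ρ₁ ρ₂ : ℝ} (hρ : LinearIndependent ℚ ![(1 : ℝ), ρ₁, ρ₂]) :
    DenseRange (fun n : ℕ => n • ((ρ₁ : UnitAddCircle), (ρ₂ : UnitAddCircle))) := by
  rw [← denseRange_zsmul_iff_nsmul]
  set x : Torus := ((ρ₁ : UnitAddCircle), (ρ₂ : UnitAddCircle)) with hx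
  let Q : ℝ →+ UnitAddCircle := QuotientAddGroup.mk' _
  let P : ℝ × ℝ →+ Torus := Q.prodMap Q
  have hP : ∀ z, P z = ((z.1 : UnitAddCircle), (z.2 : UnitAddCircle)) := fun z => rfl
  have hPc : Continuous P := (continuous_coe.comp continuous_fst).prodMk
    (continuous_coe.comp continuous_snd)
  have hPo : IsOpenMap P := isOpenMap_coe.prodMap isOpenMap_coe
  let A := (AddSubgroup.zmultiples x).topologicalClosure
  let S := A.comap P
  have hSc : IsClosed (S : Set (ℝ × ℝ)) :=
    (AddSubgroup.isClosed_topologicalClosure _).preimage hPc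
  have hxA : x ∈ A := AddSubgroup.le_topologicalClosure _ (AddSubgroup.mem_zmultiples x)
  have h1 : ((1 : ℝ) : UnitAddCircle) = 0 := AddCircle.coe_period 1
  have hsmall : ∀ ε > 0, ∃ γ ∈ S, γ ≠ 0 ∧ ‖γ‖ < ε := fun ε hε => by
    have hU : P '' Metric.ball 0 ε ∈ 𝓝 (0 : Torus) := by
      simpa using hPo.image_mem_nhds (Metric.ball_mem_nhds (0 : ℝ × ℝ) hε)
    -- Recurrence in a compact group: multiples of `x` return near `0`. Taking `n ≥ 1` makes `γ`
    -- nonzero, since `n * ρ₁` is not an integer.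
    obtain ⟨n, hn, γ, hγ, hγn⟩ := frequently_atTop.1 ((mapClusterPt_zero_atTop_nsmul x).frequently hU) 1
    refine ⟨γ, ?_, ?_, by simpa using hγ⟩
    · change P γ ∈ A
      rw [hγn]
      exact A.nsmul_mem hxA n
    · rintro rfl
      have h2 : ((0 : ℝ) : UnitAddCircle) = ((n * ρ₁ : ℝ) : UnitAddCircle) := by
        have := congrArg Prod.fst hγn
        rw [hP] at this
        simpa [hx, ← nsmul_eq_mul] using this
      obtain ⟨m, hm⟩ := coe_eq_coe_iff.1 h2
      exact irrational_of_linearIndependent hρ (n := n) (by omega) (-m) (by push_cast; linarith)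
  obtain ⟨v, hv, hvS⟩ := exists_smul_mem_of_small hSc hsmall
  have h10 : P (1, 0) ∈ A := by
    simp only [hP, h1, AddCircle.coe_zero]
    exact A.zero_mem
  have h01 : P (0, 1) ∈ A := by
    simp only [hP, h1, AddCircle.coe_zero]
    exact A.zero_mem
  have hall := dense_of_line_subset hSc hv hvS (dense_image_of_mem hρ (S := S) h10 h01 hxA hv)
  intro y
  obtain ⟨a, ha⟩ := coe_surjective y.1
  obtain ⟨b, hb⟩ := coe_surjective y.2
  have : P (a, b) ∈ A := hall (a, b)
  rw [hP] at this
  simp only [ha, hb] at this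
  have h3 : y ∈ closure (AddSubgroup.zmultiples x : Set Torus) := this
  rwa [AddSubgroup.coe_zmultiples] at h3

/-- Kronecker's theorem in dimension two, for positive multiples. -/
theorem exists_add_mul_sub_int_mem_Ioo_prod {ρ₁ ρ₂ : ℝ}
    (hρ : LinearIndependent ℚ ![(1 : ℝ), ρ₁, ρ₂]) (w₁ w₂ : ℝ) {a₁ b₁ a₂ b₂ : ℝ}
    (h₁ : a₁ < b₁) (h₂ : a₂ < b₂) : ∃ (k : ℕ) (p₁ p₂ : ℤ),
      w₁ + k * ρ₁ - p₁ ∈ Ioo a₁ b₁ ∧ w₂ + k * ρ₂ - p₂ ∈ Ioo a₂ b₂ := by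
  obtain ⟨n, ⟨x, y⟩, hx, hxn⟩ := (denseRange_nsmul_torus hρ).exists_mem_open
    ((isOpenMap_coe.prodMap isOpenMap_coe) _ ((isOpen_Ioo (a := a₁ - w₁) (b := b₁ - w₁)).prod
      (isOpen_Ioo (a := a₂ - w₂) (b := b₂ - w₂))))
    (((nonempty_Ioo.2 (by linarith)).prod (nonempty_Ioo.2 (by linarith))).image _)
  have e₁ : (x : UnitAddCircle) = ((n * ρ₁ : ℝ) : UnitAddCircle) :=
    (congrArg Prod.fst hxn).trans (by rw [← nsmul_eq_mul]; simp)
  have e₂ : (y : UnitAddCircle) = ((n * ρ₂ : ℝ) : UnitAddCircle) :=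
    (congrArg Prod.snd hxn).trans (by rw [← nsmul_eq_mul]; simp)
  obtain ⟨p, hp⟩ := coe_eq_coe_iff.1 e₁
  obtain ⟨q, hq⟩ := coe_eq_coe_iff.1 e₂
  obtain ⟨⟨i1, i2⟩, ⟨i3, i4⟩⟩ := hx
  dsimp only at i1 i2 i3 i4
  refine ⟨n, -p, -q, ⟨?_, ?_⟩, ⟨?_, ?_⟩⟩ <;> push_cast <;> linarith

/-! ### Lifts of circle homeomorphisms -/

theorem IsCircleLift.injective {G : CircleDeg1Lift} {g : UnitAddCircle ≃ₜ UnitAddCircle}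
    (h : IsCircleLift G g) : Function.Injective G := by
  intro x y hxy
  have h1 : g (x : UnitAddCircle) = g (y : UnitAddCircle) := by rw [← h.2, ← h.2, hxy]
  obtain ⟨m, rfl⟩ := coe_eq_coe_iff.1 (g.injective h1)
  rw [G.map_add_int] at hxy
  linarith

theorem IsCircleLift.strictMono {G : CircleDeg1Lift} {g : UnitAddCircle ≃ₜ UnitAddCircle}
    (h : IsCircleLift G g) : StrictMono G :=
  G.monotone.strictMono_of_injective h.injective

theorem IsCircleLift.bijective {G : CircleDeg1Lift} {g : UnitAddCircle ≃ₜ UnitAddCircle}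
    (h : IsCircleLift G g) : Function.Bijective G :=
  ⟨h.injective, h.1.surjective G.tendsto_atTop G.tendsto_atBot⟩

theorem IsCircleLift.coe_iterate {G : CircleDeg1Lift} {g : UnitAddCircle ≃ₜ UnitAddCircle}
    (h : IsCircleLift G g) (n : ℕ) (x : ℝ) :
    ((G^[n] x : ℝ) : UnitAddCircle) = g^[n] (x : UnitAddCircle) := by
  induction n with
  | zero => rfl
  | succ n ih => rw [Function.iterate_succ_apply', Function.iterate_succ_apply', h.2, ih]

theorem iterate_semiconj {G H : CircleDeg1Lift} {ρ : ℝ} (h : ∀ x, H (G x) = H x + ρ) (n : ℕ)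
    (x : ℝ) : H (G^[n] x) = H x + n * ρ := by
  induction n with
  | zero => simp
  | succ n ih =>
    rw [Function.iterate_succ_apply', h, ih]
    push_cast
    ring

/-- A monotone map reflects strict inequalities, so it is enough to steer `H x + k * ρ - p` into `(H
a, H b)`. -/
theorem exists_iterate_sub_mem_Ioo {G H : CircleDeg1Lift} {ρ : ℝ} (hρ : Irrational ρ)
    (h : ∀ x, H (G x) = H x + ρ) (N : ℕ) (x : ℝ) {a b : ℝ} (hab : H a < H b) :
    ∃ k : ℕ, N ≤ k ∧ ∃ p : ℤ, G^[k] x - p ∈ Ioo a b := by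
  obtain ⟨k, hk, p, hp⟩ := exists_add_mul_sub_int_mem_Ioo hρ N (H x) hab
  rw [← iterate_semiconj h, ← H.map_sub_int] at hp
  exact ⟨k, hk, p, H.monotone.reflect_lt hp.1, H.monotone.reflect_lt hp.2⟩

theorem exists_semiconj {G : CircleDeg1Lift} {g : UnitAddCircle ≃ₜ UnitAddCircle}
    (hG : IsCircleLift G g) (hρ : Irrational G.translationNumber) :
    ∃ H : CircleDeg1Lift, Continuous H ∧ ∀ x, H (G x) = H x + G.translationNumber := by
  set ρ := G.translationNumber with hρdef
  obtain ⟨H, hH⟩ := CircleDeg1Lift.semiconj_of_bijective_of_translationNumber_eq hG.bijective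
    (f₂ := CircleDeg1Lift.translate (Multiplicative.ofAdd ρ))
    ((CircleDeg1Lift.isUnit_iff_bijective).1 (Units.isUnit _))
    (by rw [CircleDeg1Lift.translationNumber_translate])
  have h : ∀ x, H (G x) = H x + ρ := fun x => by
    rw [hH x, CircleDeg1Lift.translate_apply, add_comm]
  -- The range contains every `H 0 + k * ρ - p`, hence is dense, and a monotone map with dense range
  -- has no jumps.
  refine ⟨H, H.monotone.continuous_of_denseRange ?_, h⟩
  refine dense_iff_exists_between.2 fun a b hab => ?_
  obtain ⟨k, -, p, hp⟩ := exists_add_mul_sub_int_mem_Ioo hρ 0 (H 0) hab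
  rw [← iterate_semiconj h, ← H.map_sub_int] at hp
  exact ⟨_, mem_range_self _, hp⟩

/-- The points at which a monotone degree one map is not locally constant. -/
def growthSet (H : CircleDeg1Lift) : Set ℝ :=
  {x | ∀ ε > 0, H (x - ε) < H (x + ε)}

theorem growthSet_nonempty (H : CircleDeg1Lift) : (growthSet H).Nonempty := by
  by_contra hne
  have hall : ∀ x, ∃ ε > 0, H (x + ε) ≤ H (x - ε) := fun x => by
    have : x ∉ growthSet H := fun hx => hne ⟨x, hx⟩
    simpa [growthSet] using this
  have hloc : IsLocallyConstant H := by
    refine (IsLocallyConstant.iff_eventually_eq _).2 fun x => ?_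
    obtain ⟨ε, hε, hx⟩ := hall x
    filter_upwards [Ioo_mem_nhds (show x - ε < x by linarith) (show x < x + ε by linarith)]
      with y hy
    have h1 := H.monotone hy.1.le
    have h2 := H.monotone hy.2.le
    have h3 := H.monotone (show x - ε ≤ x by linarith)
    have h4 := H.monotone (show x ≤ x + ε by linarith)
    linarith
  have h01 := hloc.apply_eq_of_preconnectedSpace 0 1
  have := H.map_add_one 0
  rw [zero_add] at this
  linarith

theorem isClosed_growthSet (H : CircleDeg1Lift) : IsClosed (growthSet H) := by
  rw [← isOpen_compl_iff, isOpen_iff_mem_nhds]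
  intro x hx
  have : ∃ ε > 0, H (x + ε) ≤ H (x - ε) := by simpa [growthSet] using hx
  obtain ⟨ε, hε, h⟩ := this
  filter_upwards [Ioo_mem_nhds (show x - ε / 2 < x by linarith) (show x < x + ε / 2 by linarith)]
    with y hy hmem
  have h1 := hmem (ε / 2) (by linarith)
  have h2 := H.monotone (show x - ε ≤ y - ε / 2 by linarith [hy.1])
  have h3 := H.monotone (show y + ε / 2 ≤ x + ε by linarith [hy.2])
  linarith

theorem add_int_mem_growthSet {H : CircleDeg1Lift} {x : ℝ} (hx : x ∈ growthSet H) (m : ℤ) :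
    x + m ∈ growthSet H := by
  intro ε hε
  rw [add_right_comm, add_sub_right_comm, H.map_add_int, H.map_add_int]
  linarith [hx ε hε]

theorem map_mem_growthSet_iff {G H : CircleDeg1Lift} {g : UnitAddCircle ≃ₜ UnitAddCircle} {ρ : ℝ}
    (hG : IsCircleLift G g) (h : ∀ x, H (G x) = H x + ρ) (x : ℝ) :
    G x ∈ growthSet H ↔ x ∈ growthSet H := by
  constructor
  · intro hx ε hε
    have h1 := hG.strictMono (show x - ε < x by linarith)
    have h2 := hG.strictMono (show x < x + ε by linarith)
    obtain ⟨δ, hδ, h3⟩ := exists_between (lt_min (sub_pos.2 h1) (sub_pos.2 h2))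
    have h4 := h3.trans_le (min_le_left _ _)
    have h5 := h3.trans_le (min_le_right _ _)
    have h6 := hx δ hδ
    have h7 := H.monotone (show G (x - ε) ≤ G x - δ by linarith)
    have h8 := H.monotone (show G x + δ ≤ G (x + ε) by linarith)
    rw [h] at h7 h8
    linarith
  · intro hx ε hε
    have hc := Metric.continuous_iff.1 hG.1 x ε hε
    obtain ⟨δ, hδ, hc⟩ := hc
    have h1 := hc (x - δ / 2) (by rw [Real.dist_eq, abs_lt]; constructor <;> linarith)
    have h2 := hc (x + δ / 2) (by rw [Real.dist_eq, abs_lt]; constructor <;> linarith)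
    rw [Real.dist_eq, abs_lt] at h1 h2
    have h3 := hx (δ / 2) (by linarith)
    have h4 := H.monotone (show G x - ε ≤ G (x - δ / 2) by linarith)
    have h5 := H.monotone (show G (x + δ / 2) ≤ G x + ε by linarith)
    rw [h] at h4 h5
    linarith

/-- Every orbit enters each interval across which `H` grows; an orbit starting in the closed forward
invariant `M` therefore accumulates at `x`. -/
theorem coe_mem_of_mem_growthSet {G H : CircleDeg1Lift} {g : UnitAddCircle ≃ₜ UnitAddCircle}
    {ρ : ℝ} (hρ : Irrational ρ) (hG : IsCircleLift G g) (h : ∀ x, H (G x) = H x + ρ)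
    {M : Set UnitAddCircle} (hM : M.Nonempty) (hMc : IsClosed M) (hMg : ∀ s ∈ M, g s ∈ M)
    {x : ℝ} (hx : x ∈ growthSet H) : (x : UnitAddCircle) ∈ M := by
  obtain ⟨s, hs⟩ := hM
  obtain ⟨k, rfl⟩ := coe_surjective s
  have hit : ∀ n : ℕ, g^[n] (k : UnitAddCircle) ∈ M := fun n => by
    induction n with
    | zero => exact hs
    | succ n ih => rw [Function.iterate_succ_apply']; exact hMg _ ih
  have hcl : IsClosed ((fun x : ℝ => (x : UnitAddCircle)) ⁻¹' M) := hMc.preimage continuous_coe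
  refine hcl.closure_subset (Metric.mem_closure_iff.2 fun ε hε => ?_)
  obtain ⟨n, -, p, hp⟩ := exists_iterate_sub_mem_Ioo hρ h 0 k (hx ε hε)
  refine ⟨G^[n] k - p, ?_, ?_⟩
  · rw [mem_preimage, coe_sub_int, hG.coe_iterate]
    exact hit n
  · rw [Real.dist_eq, abs_lt]
    constructor <;> linarith [hp.1, hp.2]

/-- `G` is a lift of `g`, semiconjugated by `H` to the translation by the irrational `ρ`, and `M`
is the projection of the growth set of `H`. -/
structure IsDenjoyLift (g : HomeoPlus) (ρ : ℝ) (M : Set UnitAddCircle) (G H : CircleDeg1Lift) :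
    Prop where
  isLift : IsCircleLift G g.toHomeo
  irrational : Irrational ρ
  translationNumber_eq : G.translationNumber = ρ
  continuous : Continuous H
  semiconj : ∀ x, H (G x) = H x + ρ
  mem_iff : ∀ x : ℝ, (x : UnitAddCircle) ∈ M ↔ x ∈ growthSet H

theorem IsDenjoyCounterexample.exists_lift {g : HomeoPlus} {ρ : ℝ} {M : Set UnitAddCircle}
    (hg : IsDenjoyCounterexample g ρ M) : ∃ G H : CircleDeg1Lift, IsDenjoyLift g ρ M G H := by
  obtain ⟨⟨G, hG, hGρ⟩, hρ, hM, -⟩ := hg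
  subst hGρ
  obtain ⟨H, hHc, h⟩ := exists_semiconj hG hρ
  have hMg : ∀ s ∈ M, g.toHomeo s ∈ M := fun s hs => hM.invariant ▸ mem_image_of_mem _ hs
  have hsub : ∀ x ∈ growthSet H, (x : UnitAddCircle) ∈ M := fun x hx =>
    coe_mem_of_mem_growthSet hρ hG h hM.nonempty hM.isCompact.isClosed hMg hx
  set K : Set UnitAddCircle := (fun x : ℝ => (x : UnitAddCircle)) '' growthSet H with hK
  have hKmem : ∀ x : ℝ, (x : UnitAddCircle) ∈ K ↔ x ∈ growthSet H := fun x => by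
    refine ⟨?_, fun hx => mem_image_of_mem _ hx⟩
    rintro ⟨y, hy, hyx⟩
    obtain ⟨m, rfl⟩ := coe_eq_coe_iff.1 hyx.symm
    exact add_int_mem_growthSet hy m
  have hKclosed : IsClosed K := by
    rw [← isOpen_compl_iff]
    have : Kᶜ = (fun x : ℝ => (x : UnitAddCircle)) '' (growthSet H)ᶜ := by
      ext s
      obtain ⟨x, rfl⟩ := coe_surjective s
      constructor
      · exact fun hx => ⟨x, fun hx' => hx ((hKmem x).2 hx'), rfl⟩
      · rintro ⟨y, hy, hyx⟩ hx
        rw [← hyx] at hx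
        exact hy ((hKmem y).1 hx)
    rw [this]
    exact isOpenMap_coe _ (isClosed_growthSet H).isOpen_compl
  have hKinv : g.toHomeo '' K = K := by
    ext s
    constructor
    · rintro ⟨_, ⟨x, hx, rfl⟩, rfl⟩
      exact ⟨G x, (map_mem_growthSet_iff hG h x).2 hx, hG.2 x⟩
    · rintro ⟨y, hy, rfl⟩
      obtain ⟨x, rfl⟩ := hG.bijective.2 y
      exact ⟨x, ⟨x, (map_mem_growthSet_iff hG h x).1 hy, rfl⟩, (hG.2 x).symm⟩
  -- The projected growth set is a nonempty compact invariant subset of `M`, so minimality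
  -- identifies the two.
  have hKM : K = M := hM.minimal K (by rintro _ ⟨x, hx, rfl⟩; exact hsub x hx)
    ((growthSet_nonempty H).image _) hKclosed.isCompact hKinv
  exact ⟨G, H, hG, hρ, rfl, hHc, h, fun x => hKM ▸ hKmem x⟩

namespace IsDenjoyLift

variable {g : HomeoPlus} {ρ : ℝ} {M : Set UnitAddCircle} {G H : CircleDeg1Lift}

theorem exists_iterate_mem (h : IsDenjoyLift g ρ M G H) (N : ℕ) (s : UnitAddCircle)
    {t : UnitAddCircle} (ht : t ∈ M) {U : Set UnitAddCircle} (hU : U ∈ 𝓝 t) :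
    ∃ k : ℕ, N ≤ k ∧ g.toHomeo^[k] s ∈ U := by
  obtain ⟨x, rfl⟩ := coe_surjective s
  obtain ⟨y, rfl⟩ := coe_surjective t
  obtain ⟨ε, hε, hy⟩ := Metric.mem_nhds_iff.1 (continuous_coe.continuousAt.preimage_mem_nhds hU)
  obtain ⟨k, hk, p, hp⟩ := exists_iterate_sub_mem_Ioo h.irrational h.semiconj N x
    ((h.mem_iff y).1 ht ε hε)
  refine ⟨k, hk, ?_⟩
  have h1 : G^[k] x - p ∈ Metric.ball y ε := by rwa [Real.ball_eq_Ioo]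
  have h2 := hy h1
  rwa [mem_preimage, coe_sub_int, h.isLift.coe_iterate] at h2

theorem subset_of_invariant (h : IsDenjoyLift g ρ M G H) {K : Set UnitAddCircle}
    (hK : K.Nonempty) (hKc : IsClosed K) (hKg : ∀ s ∈ K, g.toHomeo s ∈ K) : M ⊆ K := by
  intro s hs
  obtain ⟨x, rfl⟩ := coe_surjective s
  exact coe_mem_of_mem_growthSet h.irrational h.isLift h.semiconj hK hKc hKg ((h.mem_iff x).1 hs)

/-- Near a lift of `s` the map `H` is constant, so a return at time `n` would make `n * ρ` an
integer. -/
theorem exists_wandering_nhds (h : IsDenjoyLift g ρ M G H) {s : UnitAddCircle} (hs : s ∉ M) :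
    ∃ U : Set UnitAddCircle, IsOpen U ∧ s ∈ U ∧
      ∀ n : ℕ, 0 < n → ∀ t ∈ U, g.toHomeo^[n] t ∉ U := by
  obtain ⟨x, rfl⟩ := coe_surjective s
  have : ∃ ε > 0, H (x + ε) ≤ H (x - ε) := by
    simpa [growthSet] using fun hx => hs ((h.mem_iff x).2 hx)
  obtain ⟨ε, hε, hx⟩ := this
  have hconst : ∀ y ∈ Ioo (x - ε) (x + ε), H y = H (x + ε) := fun y hy =>
    le_antisymm (H.monotone hy.2.le) (hx.trans (H.monotone hy.1.le))
  refine ⟨_, isOpenMap_coe _ (isOpen_Ioo (a := x - ε) (b := x + ε)),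
    ⟨x, ⟨by linarith, by linarith⟩, rfl⟩, ?_⟩
  rintro n hn _ ⟨y, hy, rfl⟩ ⟨z, hz, hzy⟩
  have hzy' : ((G^[n] y : ℝ) : UnitAddCircle) = (z : UnitAddCircle) := by
    rw [h.isLift.coe_iterate]
    exact hzy.symm
  obtain ⟨m, hm⟩ := coe_eq_coe_iff.1 hzy'
  have h1 := iterate_semiconj h.semiconj n y
  rw [hm, H.map_add_int, hconst z hz, hconst y hy] at h1
  have h2 : Irrational ((n : ℝ) * ρ) := h.irrational.natCast_mul hn.ne'
  exact h2.ne_int m (by linarith)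

end IsDenjoyLift

/-! ### Minimal sets of skew products -/

theorem skew_iterate_fst (g : HomeoPlus) (β : C(UnitAddCircle, HomeoPlus)) (n : ℕ) (p : Torus) :
    ((skew g β)^[n] p).1 = g.toHomeo^[n] p.1 := by
  induction n with
  | zero => rfl
  | succ n ih =>
    rw [Function.iterate_succ_apply', Function.iterate_succ_apply', ← ih]
    rfl

theorem iterate_mem_of_image_eq {X : Type*} [TopologicalSpace X] {f : X ≃ₜ X} {M : Set X}
    (h : f '' M = M) {x : X} (hx : x ∈ M) (n : ℕ) : f^[n] x ∈ M := by
  induction n with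
  | zero => exact hx
  | succ n ih =>
    rw [Function.iterate_succ_apply', ← h]
    exact mem_image_of_mem _ ih

theorem skew_iterate_of_mem {g₁ g₂ : HomeoPlus} {M₁ : Set UnitAddCircle}
    (hM : g₁.toHomeo '' M₁ = M₁) (β : FibreMaps g₂ M₁) {s : UnitAddCircle} (hs : s ∈ M₁)
    (t : UnitAddCircle) (n : ℕ) :
    (skew g₁ β.1)^[n] (s, t) = (g₁.toHomeo^[n] s, g₂.toHomeo^[n] t) := by
  induction n with
  | zero => rfl
  | succ n ih =>
    rw [Function.iterate_succ_apply', ih, skew_apply, β.2 _ (iterate_mem_of_image_eq hM hs n),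
      Function.iterate_succ_apply', Function.iterate_succ_apply']

section

variable {g₁ g₂ : HomeoPlus} {ρ₁ ρ₂ : ℝ} {M₁ M₂ : Set UnitAddCircle}
  {G₁ H₁ G₂ H₂ : CircleDeg1Lift}

theorem prod_subset_of_invariant (h₁ : IsDenjoyLift g₁ ρ₁ M₁ G₁ H₁)
    (h₂ : IsDenjoyLift g₂ ρ₂ M₂ G₂ H₂) (hρ : LinearIndependent ℚ ![(1 : ℝ), ρ₁, ρ₂])
    (hM : M₁.Nonempty) (hMg : g₁.toHomeo '' M₁ = M₁) (β : FibreMaps g₂ M₁) {K : Set Torus}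
    (hK : K.Nonempty) (hKc : IsCompact K) (hKf : skew g₁ β.1 '' K = K) : M₁ ×ˢ M₂ ⊆ K := by
  -- The projection of `K` is closed and `g₁`-invariant, so `K` has a point over `M₁`; from there on
  -- the orbit is that of `g₁ × g₂`.
  have hsub : M₁ ⊆ Prod.fst '' K := by
    refine h₁.subset_of_invariant (hK.image _) (hKc.image continuous_fst).isClosed ?_
    rintro _ ⟨p, hp, rfl⟩
    exact ⟨skew g₁ β.1 p, hKf ▸ mem_image_of_mem _ hp, rfl⟩
  obtain ⟨s₀, hs₀⟩ := hM
  obtain ⟨⟨s, t⟩, hst, hss⟩ := hsub hs₀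
  obtain rfl : s = s₀ := hss
  rintro ⟨a, b⟩ ⟨ha, hb⟩
  obtain ⟨x, rfl⟩ := coe_surjective s
  obtain ⟨y, rfl⟩ := coe_surjective t
  obtain ⟨a, rfl⟩ := coe_surjective a
  obtain ⟨b, rfl⟩ := coe_surjective b
  have ha' := (h₁.mem_iff a).1 ha
  have hb' := (h₂.mem_iff b).1 hb
  refine hKc.isClosed.closure_subset (mem_closure_iff_nhds.2 fun U hU => ?_)
  have hP : Continuous fun z : ℝ × ℝ => ((z.1 : UnitAddCircle), (z.2 : UnitAddCircle)) :=
    (continuous_coe.comp continuous_fst).prodMk (continuous_coe.comp continuous_snd)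
  obtain ⟨ε, hε, hball⟩ := Metric.mem_nhds_iff.1
    (hP.continuousAt.preimage_mem_nhds (x := (a, b)) hU)
  obtain ⟨k, p, q, hp, hq⟩ := exists_add_mul_sub_int_mem_Ioo_prod hρ (H₁ x) (H₂ y)
    (ha' ε hε) (hb' ε hε)
  rw [← iterate_semiconj h₁.semiconj, ← H₁.map_sub_int] at hp
  rw [← iterate_semiconj h₂.semiconj, ← H₂.map_sub_int] at hq
  refine ⟨(skew g₁ β.1)^[k] (x, y), ?_, iterate_mem_of_image_eq hKf hst k⟩
  have hmem : (G₁^[k] x - p, G₂^[k] y - q) ∈ Metric.ball (a, b) ε := by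
    rw [← ball_prod_same, Real.ball_eq_Ioo, Real.ball_eq_Ioo]
    exact ⟨⟨H₁.monotone.reflect_lt hp.1, H₁.monotone.reflect_lt hp.2⟩,
      ⟨H₂.monotone.reflect_lt hq.1, H₂.monotone.reflect_lt hq.2⟩⟩
  have := hball hmem
  rw [mem_preimage] at this
  dsimp only at this
  rwa [coe_sub_int, coe_sub_int, h₁.isLift.coe_iterate, h₂.isLift.coe_iterate,
    ← skew_iterate_of_mem hMg β hs₀] at this

theorem skew_image_prod (hM₁ : g₁.toHomeo '' M₁ = M₁) (hM₂ : g₂.toHomeo '' M₂ = M₂)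
    (β : FibreMaps g₂ M₁) : skew g₁ β.1 '' (M₁ ×ˢ M₂) = M₁ ×ˢ M₂ := by
  have himg : ∀ s ∈ M₁, ∀ t, skew g₁ β.1 (s, t) = (g₁.toHomeo s, g₂.toHomeo t) := fun s hs t => by
    rw [skew_apply, β.2 s hs]
  ext ⟨a, b⟩
  constructor
  · rintro ⟨⟨s, t⟩, ⟨hs, ht⟩, hst⟩
    rw [himg s hs] at hst
    rw [← hst]
    exact ⟨hM₁ ▸ mem_image_of_mem _ hs, hM₂ ▸ mem_image_of_mem _ ht⟩
  · rintro ⟨ha, hb⟩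
    obtain ⟨s, hs, rfl⟩ : a ∈ g₁.toHomeo '' M₁ := hM₁.symm ▸ ha
    obtain ⟨t, ht, rfl⟩ : b ∈ g₂.toHomeo '' M₂ := hM₂.symm ▸ hb
    exact ⟨(s, t), ⟨hs, ht⟩, himg s hs t⟩

theorem isMinimalSet_skew_iff (h₁ : IsDenjoyCounterexample g₁ ρ₁ M₁)
    (h₂ : IsDenjoyCounterexample g₂ ρ₂ M₂) (hρ : LinearIndependent ℚ ![(1 : ℝ), ρ₁, ρ₂])
    (β : FibreMaps g₂ M₁) (K : Set Torus) : IsMinimalSet (skew g₁ β.1) K ↔ K = M₁ ×ˢ M₂ := by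
  obtain ⟨G₁, H₁, hl₁⟩ := h₁.exists_lift
  obtain ⟨G₂, H₂, hl₂⟩ := h₂.exists_lift
  have hM₁ := h₁.isMinimalSet
  have hM₂ := h₂.isMinimalSet
  have hinv := skew_image_prod hM₁.invariant hM₂.invariant β
  constructor
  · intro hK
    refine (hK.minimal _ ?_ (hM₁.nonempty.prod hM₂.nonempty)
      (hM₁.isCompact.prod hM₂.isCompact) hinv).symm
    exact prod_subset_of_invariant hl₁ hl₂ hρ hM₁.nonempty hM₁.invariant β hK.nonempty
      hK.isCompact hK.invariant
  · rintro rfl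
    exact ⟨hM₁.nonempty.prod hM₂.nonempty, hM₁.isCompact.prod hM₂.isCompact, hinv,
      fun K hKs hKn hKc hKf => hKs.antisymm (prod_subset_of_invariant hl₁ hl₂ hρ hM₁.nonempty
        hM₁.invariant β hKn hKc hKf)⟩

end

/-! ### Rotation vectors of skew products -/

theorem continuous_homeoPlus_apply {X : Type*} [TopologicalSpace X] {b : X → HomeoPlus}
    {c : X → UnitAddCircle} (hb : Continuous b) (hc : Continuous c) :
    Continuous fun x => (b x).toHomeo (c x) := by
  have h1 : Continuous fun x => (b x).toMap := continuous_induced_dom.comp hb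
  exact h1.eval hc

/-- The displacement of a continuous degree one map is a function on the circle. -/
theorem exists_displacement {G : CircleDeg1Lift} (hG : Continuous G) :
    ∃ φ : C(UnitAddCircle, ℝ), ∀ x : ℝ, φ (x : UnitAddCircle) = G x - x := by
  have hper : Function.Periodic (fun x : ℝ => G x - x) 1 := fun x => by
    dsimp only
    rw [G.map_add_one]
    ring
  exact ⟨⟨hper.lift, continuous_quot_lift _ (hG.sub continuous_id)⟩, fun x => hper.lift_coe x⟩

theorem abs_sub_le_of_deg1 (H : CircleDeg1Lift) (x : ℝ) : |H x - x| ≤ |H 0| + 1 := by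
  have h1 := H.map_le_of_map_zero x
  have h2 := H.le_map_of_map_zero x
  have h3 := Int.ceil_lt_add_one x
  have h4 := Int.sub_one_lt_floor x
  have h5 := le_abs_self (H 0)
  have h6 := neg_abs_le (H 0)
  rw [abs_le]
  constructor <;> linarith

theorem uniformContinuous_of_deg1 {H : CircleDeg1Lift} (hH : Continuous H) :
    UniformContinuous H := by
  obtain ⟨φ, hφ⟩ := exists_displacement hH
  have h1 : UniformContinuous fun x : ℝ => φ (x : UnitAddCircle) + x :=
    ((CompactSpace.uniformContinuous_of_continuous φ.continuous).comp
      (uniformContinuous_addMonoidHom_of_continuous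
        (f := QuotientAddGroup.mk' (AddSubgroup.zmultiples (1 : ℝ))) continuous_coe)).add
      uniformContinuous_id
  convert! h1 using 2 with x
  rw [hφ]
  ring

theorem rotationSet_eq_singleton {F : ℝ × ℝ → ℝ × ℝ} {v : ℝ × ℝ}
    (h : ∀ η > 0, ∃ C, ∀ (n : ℕ) (z : ℝ × ℝ), ‖F^[n] z - z - (n : ℝ) • v‖ ≤ n * η + C) :
    rotationSet F = {v} := by
  have hlim : ∀ (n : ℕ → ℕ) (z : ℕ → ℝ × ℝ), Tendsto n atTop atTop →
      Tendsto (fun i => (n i : ℝ)⁻¹ • (F^[n i] (z i) - z i)) atTop (𝓝 v) := by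
    intro n z hn
    rw [Metric.tendsto_nhds]
    intro ε hε
    obtain ⟨C, hC⟩ := h (ε / 2) (by linarith)
    have h1 : Tendsto (fun i => ε / 2 + C * (n i : ℝ)⁻¹) atTop (𝓝 (ε / 2 + C * 0)) :=
      ((tendsto_inv_atTop_zero.comp (tendsto_natCast_atTop_atTop.comp hn)).const_mul C).const_add _
    filter_upwards [h1.eventually_lt_const (show ε / 2 + C * 0 < ε by linarith),
      hn.eventually_ge_atTop 1] with i hi hi1
    have hpos : (0 : ℝ) < n i := by exact_mod_cast hi1
    refine lt_of_le_of_lt ?_ hi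
    have h2 : (n i : ℝ)⁻¹ • (F^[n i] (z i) - z i) - v =
        (n i : ℝ)⁻¹ • (F^[n i] (z i) - z i - (n i : ℝ) • v) := by
      rw [smul_sub _ (F^[n i] (z i) - z i), inv_smul_smul₀ hpos.ne']
    rw [dist_eq_norm, h2, norm_smul, Real.norm_eq_abs, abs_of_pos (inv_pos.2 hpos)]
    calc (n i : ℝ)⁻¹ * ‖F^[n i] (z i) - z i - (n i : ℝ) • v‖
        ≤ (n i : ℝ)⁻¹ * (n i * (ε / 2) + C) := by gcongr; exact hC _ _
      _ = ε / 2 + C * (n i : ℝ)⁻¹ := by field_simp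
  ext w
  constructor
  · rintro ⟨n, z, hn, hw⟩
    exact tendsto_nhds_unique hw (hlim n z hn)
  · rintro rfl
    exact ⟨id, fun _ => 0, tendsto_id, hlim _ _ tendsto_id⟩

/-! ### Visits of base orbits to compact sets off the minimal set -/

open Classical in
theorem card_visits_le_one {g : UnitAddCircle ≃ₜ UnitAddCircle} {U : Set UnitAddCircle}
    (hU : ∀ n : ℕ, 0 < n → ∀ t ∈ U, g^[n] t ∉ U) (s : UnitAddCircle) (n : ℕ) :
    ((Finset.range n).filter fun k => g^[k] s ∈ U).card ≤ 1 := by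
  have key : ∀ a b : ℕ, a < b → g^[a] s ∈ U → g^[b] s ∉ U := fun a b hab ha hb => by
    refine hU (b - a) (by omega) _ ha ?_
    rwa [← Function.iterate_add_apply, Nat.sub_add_cancel hab.le]
  refine Finset.card_le_one.2 fun a ha b hb => ?_
  simp only [Finset.mem_filter] at ha hb
  rcases lt_trichotomy a b with h | h | h
  · exact absurd hb.2 (key a b h ha.2)
  · exact h
  · exact absurd ha.2 (key b a h hb.2)

open Classical in
-- Finitely many wandering neighbourhoods cover `C`, and an orbit visits each at most once. The
-- bound depends neither on the point nor on the time.
theorem IsDenjoyLift.exists_card_visits_le {g : HomeoPlus} {ρ : ℝ} {M : Set UnitAddCircle}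
    {G H : CircleDeg1Lift} (h : IsDenjoyLift g ρ M G H) {C : Set UnitAddCircle} (hC : IsCompact C)
    (hCM : Disjoint C M) : ∃ N : ℕ, ∀ (s : UnitAddCircle) (n : ℕ),
      ((Finset.range n).filter fun k => g.toHomeo^[k] s ∈ C).card ≤ N := by
  choose! U hUo hsU hU using fun (s : UnitAddCircle) (hs : s ∈ C) =>
    h.exists_wandering_nhds (disjoint_left.1 hCM hs)
  obtain ⟨T, hTC, hT⟩ := hC.elim_nhds_subcover U fun s hs => (hUo s hs).mem_nhds (hsU s hs)
  refine ⟨T.card, fun s n => ?_⟩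
  have hsub : ((Finset.range n).filter fun k => g.toHomeo^[k] s ∈ C) ⊆
      T.biUnion fun x => (Finset.range n).filter fun k => g.toHomeo^[k] s ∈ U x := fun k hk => by
    simp only [Finset.mem_filter, Finset.mem_biUnion] at hk ⊢
    obtain ⟨x, hx, hkx⟩ := mem_iUnion₂.1 (hT hk.2)
    exact ⟨x, hx, hk.1, hkx⟩
  calc _ ≤ _ := Finset.card_le_card hsub
    _ ≤ _ := Finset.card_biUnion_le
    _ ≤ ∑ x ∈ T, 1 := Finset.sum_le_sum fun x hx => card_visits_le_one (hU x (hTC x hx)) s n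
    _ = T.card := by simp

/-- `φ` is a real valued lift of the difference of `f_β` and `g₁ × g₂` in the second coordinate,
vanishing over `M`. -/
structure IsDeviation (g : HomeoPlus) (M : Set UnitAddCircle) (β : FibreMaps g M)
    (φ : C(Torus, ℝ)) : Prop where
  eq_zero : ∀ s ∈ M, ∀ t, φ (s, t) = 0
  apply_eq : ∀ s t, (β.1 s).toHomeo t = g.toHomeo t + (φ (s, t) : UnitAddCircle)

theorem abs_iterate_sub_le {G H : CircleDeg1Lift} {ρ : ℝ} (h : ∀ x, H (G x) = H x + ρ) (n : ℕ)
    (x : ℝ) : |G^[n] x - x - n * ρ| ≤ 2 * (|H 0| + 1) := by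
  have h1 := iterate_semiconj h n x
  have h2 := abs_le.1 (abs_sub_le_of_deg1 H x)
  have h3 := abs_le.1 (abs_sub_le_of_deg1 H (G^[n] x))
  rw [abs_le]
  constructor <;> linarith [h2.1, h2.2, h3.1, h3.2]

section

variable {g₁ g₂ : HomeoPlus} {ρ₁ ρ₂ : ℝ} {M₁ M₂ : Set UnitAddCircle}
  {G₁ H₁ G₂ H₂ : CircleDeg1Lift}

theorem isHomotopicToId_skew (h₁ : IsCircleLift G₁ g₁.toHomeo) (h₂ : IsCircleLift G₂ g₂.toHomeo)
    {β : FibreMaps g₂ M₁} {φ : C(Torus, ℝ)} (hφ : IsDeviation g₂ M₁ β φ) :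
    IsHomotopicToId (skew g₁ β.1) := by
  obtain ⟨φ₁, hφ₁⟩ := exists_displacement h₁.1
  obtain ⟨φ₂, hφ₂⟩ := exists_displacement h₂.1
  have e₁ : ∀ s, g₁.toHomeo s = s + (φ₁ s : UnitAddCircle) := fun s => by
    obtain ⟨x, rfl⟩ := coe_surjective s
    rw [hφ₁, ← AddCircle.coe_add, add_sub_cancel, h₁.2]
  have e₂ : ∀ s, g₂.toHomeo s = s + (φ₂ s : UnitAddCircle) := fun s => by
    obtain ⟨x, rfl⟩ := coe_surjective s
    rw [hφ₂, ← AddCircle.coe_add, add_sub_cancel, h₂.2]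
  -- Both coordinates have real-valued displacements, which are scaled linearly to `0`.
  refine ⟨⟨⟨fun z => (z.2.1 + (((1 - (z.1 : ℝ)) * φ₁ z.2.1 : ℝ) : UnitAddCircle),
    z.2.2 + (((1 - (z.1 : ℝ)) * (φ₂ z.2.2 + φ z.2) : ℝ) : UnitAddCircle)), ?_⟩, ?_, ?_⟩⟩
  · refine Continuous.prodMk ?_ ?_
    · exact (by fun_prop : Continuous fun z : unitInterval × Torus => z.2.1).add
        (continuous_coe.comp (by fun_prop))
    · exact (by fun_prop : Continuous fun z : unitInterval × Torus => z.2.2).add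
        (continuous_coe.comp (by fun_prop))
  · rintro ⟨s, t⟩
    change _ = skew g₁ β.1 (s, t)
    rw [skew_apply, hφ.apply_eq, e₁, e₂]
    simp [add_assoc]
  · rintro ⟨s, t⟩
    simp

/-- In the coordinate `H₂`, each step adds `ρ₂` plus the error caused by `φ`. That error is below
`η` when `|φ| < δ` and at most `B` always; `|φ| ≥ δ` requires the base point to be in `C`, so it
occurs at most `N` times. Passing through `H₂` costs only a bounded amount. -/
theorem rotationSet_skew_lift (h₁ : IsDenjoyLift g₁ ρ₁ M₁ G₁ H₁)
    (h₂ : IsDenjoyLift g₂ ρ₂ M₂ G₂ H₂) {β : FibreMaps g₂ M₁} {φ : C(Torus, ℝ)}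
    (hφ : IsDeviation g₂ M₁ β φ) :
    rotationSet (fun z : ℝ × ℝ => (G₁ z.1,
      G₂ z.2 + φ ((z.1 : UnitAddCircle), (z.2 : UnitAddCircle)))) = {(ρ₁, ρ₂)} := by
  classical
  set F : ℝ × ℝ → ℝ × ℝ := fun z => (G₁ z.1,
      G₂ z.2 + φ ((z.1 : UnitAddCircle), (z.2 : UnitAddCircle))) with hF
  have hfst : ∀ (n : ℕ) (z : ℝ × ℝ), (F^[n] z).1 = G₁^[n] z.1 := fun n z => by
    induction n with
    | zero => rfl
    | succ n ih => rw [Function.iterate_succ_apply', Function.iterate_succ_apply', ← ih]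
  refine rotationSet_eq_singleton fun η hη => ?_
  obtain ⟨δ, hδ, hδH⟩ := Metric.uniformContinuous_iff.1
    (uniformContinuous_of_deg1 h₂.continuous) η hη
  set C : Set UnitAddCircle := Prod.fst '' {p : Torus | δ ≤ |φ p|} with hC
  have hCc : IsCompact C :=
    (isClosed_le continuous_const φ.continuous.abs).isCompact.image continuous_fst
  have hCM : Disjoint C M₁ := by
    rw [disjoint_left]
    rintro _ ⟨⟨s, t⟩, hst, rfl⟩ hs
    have h0 : δ ≤ |φ (s, t)| := hst
    rw [hφ.eq_zero s hs, abs_zero] at h0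
    linarith
  obtain ⟨N, hN⟩ := h₁.exists_card_visits_le hCc hCM
  set B : ℝ := ‖φ‖ + 2 * (|H₂ 0| + 1) with hB
  have hB0 : 0 ≤ B := by positivity
  have hstep : ∀ (n : ℕ) (z : ℝ × ℝ), |H₂ (F^[n] z).2 - H₂ z.2 - n * ρ₂| ≤
      n * η + B * ((Finset.range n).filter fun k => g₁.toHomeo^[k] z.1 ∈ C).card := fun n z => by
    induction n with
    | zero => simp
    | succ n ih =>
      set y := F^[n] z with hy
      set ψ := φ ((y.1 : UnitAddCircle), (y.2 : UnitAddCircle)) with hψ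
      have hnext : (F^[n + 1] z).2 = G₂ y.2 + ψ := by
        rw [Function.iterate_succ_apply']
      have hsemi := h₂.semiconj y.2
      have hy1 : (y.1 : UnitAddCircle) = g₁.toHomeo^[n] z.1 := by
        rw [hy, hfst, h₁.isLift.coe_iterate]
      have htri : |H₂ (F^[n + 1] z).2 - H₂ z.2 - (n + 1 : ℕ) * ρ₂| ≤
          |H₂ y.2 - H₂ z.2 - n * ρ₂| + |H₂ (G₂ y.2 + ψ) - H₂ (G₂ y.2)| := by
        refine le_trans (le_of_eq ?_) (abs_add_le _ _)
        rw [hnext, hsemi]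
        push_cast
        congr 1
        ring
      rw [Finset.range_add_one, Finset.filter_insert]
      split_ifs with hvis
      · rw [Finset.card_insert_of_notMem (by simp)]
        have hbound : |H₂ (G₂ y.2 + ψ) - H₂ (G₂ y.2)| ≤ B := by
          have b1 := abs_le.1 (abs_sub_le_of_deg1 H₂ (G₂ y.2 + ψ))
          have b2 := abs_le.1 (abs_sub_le_of_deg1 H₂ (G₂ y.2))
          have b3 := abs_le.1 (φ.norm_coe_le_norm ((y.1 : UnitAddCircle), (y.2 : UnitAddCircle)))
          rw [abs_le]
          constructor <;> linarith [b1.1, b1.2, b2.1, b2.2, b3.1, b3.2]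
        push_cast at *
        linarith
      · have hsmall : |ψ| < δ := by
          by_contra hge
          exact hvis (hy1 ▸ ⟨_, not_lt.1 hge, rfl⟩)
        have hbound := hδH (a := G₂ y.2 + ψ) (b := G₂ y.2)
          (by rwa [Real.dist_eq, add_sub_cancel_left])
        rw [Real.dist_eq] at hbound
        push_cast at *
        linarith
  refine ⟨B * N + 2 * (|H₁ 0| + 1) + 2 * (|H₂ 0| + 1), fun n z => ?_⟩
  have hcard : (((Finset.range n).filter fun k => g₁.toHomeo^[k] z.1 ∈ C).card : ℝ) ≤ N := by
    exact_mod_cast hN z.1 n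
  have hBN := mul_le_mul_of_nonneg_left hcard hB0
  have hnη : 0 ≤ (n : ℝ) * η := by positivity
  have p1 := abs_nonneg (H₁ 0)
  have p2 := abs_nonneg (H₂ 0)
  have p3 : 0 ≤ B * N := by positivity
  rw [norm_prod_le_iff]
  constructor
  · have := abs_iterate_sub_le h₁.semiconj n z.1
    simp only [Prod.fst_sub, Prod.smul_fst, smul_eq_mul, hfst, Real.norm_eq_abs]
    linarith
  · have b1 := abs_le.1 (abs_sub_le_of_deg1 H₂ (F^[n] z).2)
    have b2 := abs_le.1 (abs_sub_le_of_deg1 H₂ z.2)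
    have b3 := abs_le.1 (hstep n z)
    simp only [Prod.snd_sub, Prod.smul_snd, smul_eq_mul, Real.norm_eq_abs]
    rw [abs_le]
    constructor <;> linarith [b1.1, b1.2, b2.1, b2.2, b3.1, b3.2]

theorem hasUniqueRotationVector_skew (h₁ : IsDenjoyLift g₁ ρ₁ M₁ G₁ H₁)
    (h₂ : IsDenjoyLift g₂ ρ₂ M₂ G₂ H₂) {β : FibreMaps g₂ M₁} {φ : C(Torus, ℝ)}
    (hφ : IsDeviation g₂ M₁ β φ) : HasUniqueRotationVector (skew g₁ β.1) (ρ₁, ρ₂) := by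
  refine ⟨_, ⟨?_, fun z => ?_⟩, rotationSet_skew_lift h₁ h₂ hφ⟩
  · refine (h₁.isLift.1.comp continuous_fst).prodMk ((h₂.isLift.1.comp continuous_snd).add
      (φ.continuous.comp ((continuous_coe.comp continuous_fst).prodMk
        (continuous_coe.comp continuous_snd))))
  · rw [skew_apply, hφ.apply_eq, ← h₁.isLift.2, ← h₂.isLift.2, AddCircle.coe_add]

theorem isNonResonant_skew (h₁ : IsDenjoyLift g₁ ρ₁ M₁ G₁ H₁)
    (h₂ : IsDenjoyLift g₂ ρ₂ M₂ G₂ H₂) (hρ : LinearIndependent ℚ ![(1 : ℝ), ρ₁, ρ₂])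
    {β : FibreMaps g₂ M₁} {φ : C(Torus, ℝ)} (hφ : IsDeviation g₂ M₁ β φ) :
    IsNonResonant (skew g₁ β.1) :=
  ⟨isHomotopicToId_skew h₁.isLift h₂.isLift hφ, _, hasUniqueRotationVector_skew h₁ h₂ hφ, hρ⟩

end

/-- Lift the difference between the homotopy and `g` to `ℝ`, starting from `0` at the constant end.
Over `M` the difference is `0` at all times, so by uniqueness of lifts it stays `0` there. -/
theorem exists_deviation_of_homotopicRel {g : HomeoPlus} {M : Set UnitAddCircle}
    {β : FibreMaps g M}
    (h : ContinuousMap.HomotopicRel β.1 (ContinuousMap.const UnitAddCircle g) M) :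
    ∃ φ : C(Torus, ℝ), IsDeviation g M β φ := by
  obtain ⟨B⟩ := h.symm
  have cov : IsCoveringMap (fun x : ℝ => (x : UnitAddCircle)) := AddCircle.isCoveringMap_coe 1
  let D : C(unitInterval × Torus, UnitAddCircle) :=
    ⟨fun z => (B (z.1, z.2.1)).toHomeo z.2.2 - g.toHomeo z.2.2, by
      refine (continuous_homeoPlus_apply (B.continuous.comp ?_) ?_).sub
        (g.toHomeo.continuous.comp ?_) <;> fun_prop⟩
  have hD : ∀ z, D z = (B (z.1, z.2.1)).toHomeo z.2.2 - g.toHomeo z.2.2 := fun z => rfl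
  have hD0 : ∀ a : Torus, D (0, a) = ((ContinuousMap.const Torus (0 : ℝ) a : ℝ) : UnitAddCircle) :=
    fun a => by
      rw [hD, B.apply_zero]
      simp
  have hL := cov.liftHomotopy_lifts D (ContinuousMap.const Torus (0 : ℝ)) hD0
  have hL0 := cov.liftHomotopy_zero D (ContinuousMap.const Torus (0 : ℝ)) hD0
  set L := cov.liftHomotopy D (ContinuousMap.const Torus (0 : ℝ)) hD0
  refine ⟨⟨fun a => L (1, a), L.continuous.comp (by fun_prop)⟩, fun s hs t => ?_, fun s t => ?_⟩
  · have hzero : (fun u => L (u, (s, t))) = fun _ => (0 : ℝ) := by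
      refine cov.eq_of_comp_eq (L.continuous.comp (by fun_prop)) continuous_const ?_ 0 (hL0 (s, t))
      funext u
      have h1 := congrFun hL (u, (s, t))
      have h2 : B (u, s) = g := B.eq_fst u hs
      simp only [Function.comp_apply] at h1 ⊢
      rw [h1, hD, h2]
      simp
    exact congrFun hzero 1
  · have h1 := congrFun hL (1, (s, t))
    rw [hD, B.apply_one] at h1
    exact (sub_eq_iff_eq_add'.1 h1.symm)

/-! ### Small real lifts of circle valued maps -/

/-- The representative in `(-1/2, 1/2]` of a point of the circle. -/
noncomputable def smallLift (s : UnitAddCircle) : ℝ := (AddCircle.equivIoc 1 (-(1 / 2)) s : ℝ)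

theorem coe_smallLift (s : UnitAddCircle) : ((smallLift s : ℝ) : UnitAddCircle) = s :=
  AddCircle.coe_equivIoc

theorem abs_smallLift (s : UnitAddCircle) : |smallLift s| = ‖s‖ := by
  have h := (AddCircle.equivIoc 1 (-(1 / 2) : ℝ) s).2
  have h1 : |smallLift s| ≤ |(1 : ℝ)| / 2 := by
    have h2 : smallLift s ∈ Ioc (-(1 / 2) : ℝ) (-(1 / 2) + 1) := h
    rw [abs_one, abs_le]
    constructor <;> linarith [h2.1, h2.2]
  rw [← (AddCircle.norm_coe_eq_abs_iff (p := (1 : ℝ)) one_ne_zero).2 h1, coe_smallLift]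

theorem smallLift_zero : smallLift 0 = 0 := by
  rw [← abs_eq_zero, abs_smallLift, norm_zero]

theorem continuousAt_smallLift {s : UnitAddCircle} (hs : ‖s‖ < 1 / 2) :
    ContinuousAt smallLift s := by
  refine continuous_subtype_val.continuousAt.comp (AddCircle.continuousAt_equivIoc 1 _ ?_)
  rintro rfl
  rw [(AddCircle.norm_coe_eq_abs_iff (p := (1 : ℝ)) one_ne_zero).2 (by norm_num)] at hs
  norm_num at hs

theorem continuous_smallLift_comp {X : Type*} [TopologicalSpace X] {f : X → UnitAddCircle}
    (hf : Continuous f) (h : ∀ x, ‖f x‖ < 1 / 2) : Continuous fun x => smallLift (f x) :=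
  continuous_iff_continuousAt.2 fun x =>
    (continuousAt_smallLift (h x)).comp (f := f) hf.continuousAt

theorem norm_coe_le_abs (x : ℝ) : ‖(x : UnitAddCircle)‖ ≤ |x| := by
  rw [UnitAddCircle.norm_eq]
  have := round_le x 0
  simpa using this

/-- A homeomorphism uniformly close to an orientation preserving one preserves orientation. -/
theorem exists_lift_of_norm_sub_lt {h : UnitAddCircle ≃ₜ UnitAddCircle} (k : HomeoPlus)
    (hk : ∀ t, ‖h t - k.toHomeo t‖ < 1 / 2) : ∃ G : CircleDeg1Lift, IsCircleLift G h := by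
  obtain ⟨K, hK⟩ := k.exists_lift
  set F : ℝ → ℝ := fun x => K x + smallLift (h x - k.toHomeo x) with hF
  have hFc : Continuous F := hK.1.add ((continuous_smallLift_comp
    (h.continuous.sub k.toHomeo.continuous) hk).comp continuous_coe)
  have hFh : ∀ x : ℝ, ((F x : ℝ) : UnitAddCircle) = h x := fun x => by
    rw [hF, AddCircle.coe_add, coe_smallLift, hK.2]
    abel
  have hFint : ∀ (x : ℝ) (m : ℤ), F (x + m) = F x + m := fun x m => by
    simp only [hF, K.map_add_int, coe_add_int]
    ring
  have hinj : Function.Injective F := fun x y hxy => by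
    have h1 : h (x : UnitAddCircle) = h (y : UnitAddCircle) := by rw [← hFh, ← hFh, hxy]
    obtain ⟨m, rfl⟩ := coe_eq_coe_iff.1 (h.injective h1)
    rw [hFint] at hxy
    linarith
  have hone := hFint 0 1
  rw [Int.cast_one] at hone
  -- A continuous injection of `ℝ` is strictly monotone, and `F (0 + 1) = F 0 + 1` rules out
  -- decreasing.
  have hmono : StrictMono F := (hFc.strictMono_of_inj hinj).resolve_right fun hanti => by
    have := hanti (show (0 : ℝ) < 0 + 1 by norm_num)
    linarith
  exact ⟨⟨⟨F, hmono.monotone⟩, fun x => by simpa using hFint x 1⟩, hFc, hFh⟩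

/-! ### The space of fibre maps -/

theorem HomeoPlus.ext_toHomeo {g h : HomeoPlus} (H : ∀ t, g.toHomeo t = h.toHomeo t) : g = h := by
  obtain ⟨g, hg⟩ := g
  obtain ⟨h, hh⟩ := h
  obtain rfl : g = h := Homeomorph.ext H
  rfl

theorem continuous_toMap : Continuous HomeoPlus.toMap := continuous_induced_dom

theorem continuous_homeoPlus_of_uncurry {X : Type*} [TopologicalSpace X] {b : X → HomeoPlus}
    (h : Continuous fun p : X × UnitAddCircle => (b p.1).toHomeo p.2) : Continuous b :=
  continuous_induced_rng.2 (ContinuousMap.continuous_of_continuous_uncurry _ h)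

/-- The identity, as an orientation preserving homeomorphism. -/
def HomeoPlus.refl : HomeoPlus :=
  ⟨Homeomorph.refl _, 1, continuous_id, fun _ => rfl⟩

section FibreMaps

variable {g : HomeoPlus} {M : Set UnitAddCircle}

/-- A fibre map as a map `(s, t) ↦ β(s)(t)` on the torus. -/
def FibreMaps.eval (β : FibreMaps g M) : C(Torus, UnitAddCircle) :=
  ⟨fun p => (β.1 p.1).toHomeo p.2,
    continuous_homeoPlus_apply (β.1.continuous.comp continuous_fst) continuous_snd⟩

/-- The map `(s, t) ↦ β(s)⁻¹(t)` on the torus. -/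
def FibreMaps.evalSymm (β : FibreMaps g M) : C(Torus, UnitAddCircle) :=
  -- Joint continuity of the fibrewise inverses comes from the skew product over the identity being
  -- a homeomorphism of a compact space.
  ⟨fun p => ((skew HomeoPlus.refl β.1).symm p).2,
    continuous_snd.comp (skew HomeoPlus.refl β.1).symm.continuous⟩

theorem FibreMaps.eval_apply (β : FibreMaps g M) (p : Torus) :
    FibreMaps.eval β p = (β.1 p.1).toHomeo p.2 := rfl

theorem FibreMaps.evalSymm_apply (β : FibreMaps g M) (p : Torus) :
    FibreMaps.evalSymm β p = (β.1 p.1).toHomeo.symm p.2 := rfl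

theorem isInducing_eval : IsInducing (FibreMaps.eval : FibreMaps g M → C(Torus, UnitAddCircle)) :=
  ((Homeomorph.curry (X := UnitAddCircle) (Y := UnitAddCircle) (Z := UnitAddCircle)).symm.isInducing.comp
    (ContinuousMap.isInducing_postcomp ⟨HomeoPlus.toMap, continuous_toMap⟩ ⟨rfl⟩)).comp
      IsInducing.subtypeVal

theorem exists_forall_mem_of_mem_nhds {β₀ : FibreMaps g M} {W : Set (FibreMaps g M)}
    (hW : W ∈ 𝓝 β₀) : ∃ ε > 0, ∀ β : FibreMaps g M,
      (∀ p, dist (FibreMaps.eval β p) (FibreMaps.eval β₀ p) ≤ ε) → β ∈ W := by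
  rw [isInducing_eval.nhds_eq_comap, mem_comap] at hW
  obtain ⟨V, hV, hVW⟩ := hW
  obtain ⟨r, hr, hball⟩ := Metric.mem_nhds_iff.1 hV
  refine ⟨r / 2, by linarith, fun β hβ => hVW (hball ?_)⟩
  rw [Metric.mem_ball]
  exact ((ContinuousMap.dist_le (by linarith)).2 hβ).trans_lt (by linarith)

theorem continuous_evalSymm :
    Continuous (FibreMaps.evalSymm : FibreMaps g M → C(Torus, UnitAddCircle)) := by
  rw [continuous_iff_continuousAt]
  intro β₀
  refine Metric.tendsto_nhds.2 fun ε hε => ?_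
  obtain ⟨δ, hδ, h⟩ := Metric.uniformContinuous_iff.1
    (CompactSpace.uniformContinuous_of_continuous (FibreMaps.evalSymm β₀).continuous) ε hε
  filter_upwards [isInducing_eval.continuous.continuousAt.preimage_mem_nhds
    (Metric.ball_mem_nhds (FibreMaps.eval β₀) hδ)] with β hβ
  rw [ContinuousMap.dist_lt_iff hε]
  rintro ⟨s, t⟩
  obtain ⟨u, rfl⟩ := (β.1 s).toHomeo.surjective t
  have h1 : dist (FibreMaps.eval β (s, u)) (FibreMaps.eval β₀ (s, u)) < δ :=
    (ContinuousMap.dist_apply_le_dist _).trans_lt hβ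
  -- With `t = β(s)(u)`, both inverses at `t` become values of `β₀(s)⁻¹` at nearby points: `u =
  -- β₀(s)⁻¹(β₀(s)(u))`.
  have h2 := h (a := (s, (β₀.1 s).toHomeo u)) (b := (s, (β.1 s).toHomeo u)) (by
    rw [Prod.dist_eq, dist_self, dist_comm]
    exact max_lt hδ h1)
  rw [FibreMaps.evalSymm_apply, FibreMaps.evalSymm_apply] at h2
  rw [FibreMaps.evalSymm_apply, FibreMaps.evalSymm_apply]
  simpa using h2

/-- This makes the space of fibre maps completely metrizable, hence Baire. Recording the inverse
turns being a homeomorphism into a closed condition; orientation survives limits because a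
homeomorphism within `1/2` of an orientation preserving one preserves orientation. -/
theorem isClosedEmbedding_eval_evalSymm : IsClosedEmbedding
    (fun β : FibreMaps g M => (FibreMaps.eval β, FibreMaps.evalSymm β)) := by
  have hcont : Continuous (fun β : FibreMaps g M => (FibreMaps.eval β, FibreMaps.evalSymm β)) :=
    isInducing_eval.continuous.prodMk continuous_evalSymm
  refine ⟨⟨IsInducing.of_comp hcont continuous_fst isInducing_eval, fun β β' h => ?_⟩, ?_⟩
  · refine Subtype.ext (ContinuousMap.ext fun s => HomeoPlus.ext_toHomeo fun t => ?_)
    exact DFunLike.congr_fun (congrArg Prod.fst h) (s, t)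
  · refine isClosed_of_closure_subset ?_
    rintro ⟨a, b⟩ hab
    have hclosed : IsClosed {z : C(Torus, UnitAddCircle) × C(Torus, UnitAddCircle) |
        ∀ s t, z.1 (s, z.2 (s, t)) = t ∧ z.2 (s, z.1 (s, t)) = t ∧
          (s ∈ M → z.1 (s, t) = g.toHomeo t)} := by
      simp only [ofPred_forall, ofPred_and]
      refine isClosed_iInter fun s => isClosed_iInter fun t => ?_
      have e₁ : ∀ c : C(Torus, UnitAddCircle) × C(Torus, UnitAddCircle) → UnitAddCircle,
          Continuous c → Continuous fun z : C(Torus, UnitAddCircle) × C(Torus, UnitAddCircle) =>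
            z.1 (s, c z) := fun c hc =>
        continuous_fst.eval (continuous_const.prodMk hc)
      have e₂ : ∀ c : C(Torus, UnitAddCircle) × C(Torus, UnitAddCircle) → UnitAddCircle,
          Continuous c → Continuous fun z : C(Torus, UnitAddCircle) × C(Torus, UnitAddCircle) =>
            z.2 (s, c z) := fun c hc =>
        continuous_snd.eval (continuous_const.prodMk hc)
      refine (isClosed_eq (e₁ _ (e₂ _ continuous_const)) continuous_const).inter
        ((isClosed_eq (e₂ _ (e₁ _ continuous_const)) continuous_const).inter ?_)
      exact isClosed_iInter fun _ => isClosed_eq (e₁ _ continuous_const) continuous_const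
    have hmem := hclosed.closure_subset_iff.2 (by
      rintro _ ⟨β, rfl⟩ s t
      refine ⟨?_, ?_, fun hs => ?_⟩
      · simp [FibreMaps.eval_apply, FibreMaps.evalSymm_apply]
      · simp [FibreMaps.eval_apply, FibreMaps.evalSymm_apply]
      · simp [FibreMaps.eval_apply, β.2 s hs]) hab
    obtain ⟨_, ⟨β, rfl⟩, hβ⟩ := Metric.mem_closure_iff.1 hab (1 / 2) (by norm_num)
    let h (s : UnitAddCircle) : UnitAddCircle ≃ₜ UnitAddCircle :=
      { toFun := fun t => a (s, t)
        invFun := fun t => b (s, t)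
        left_inv := fun t => (hmem s t).2.1
        right_inv := fun t => (hmem s t).1
        continuous_toFun := a.continuous.comp (by fun_prop)
        continuous_invFun := b.continuous.comp (by fun_prop) }
    have hlift : ∀ s, ∃ G : CircleDeg1Lift, IsCircleLift G (h s) := fun s =>
      exists_lift_of_norm_sub_lt (β.1 s) fun t => by
        have h1 : dist a (FibreMaps.eval β) < 1 / 2 := (le_max_left _ _).trans_lt hβ
        rw [← dist_eq_norm]
        exact (ContinuousMap.dist_apply_le_dist (f := a) (g := FibreMaps.eval β) (s, t)).trans_lt h1
    let β' : FibreMaps g M := ⟨⟨fun s => ⟨h s, hlift s⟩, continuous_homeoPlus_of_uncurry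
      a.continuous⟩, fun s hs => HomeoPlus.ext_toHomeo fun t => (hmem s t).2.2 hs⟩
    exact ⟨β', rfl⟩

instance : BaireSpace (FibreMaps g M) := by
  have := (isClosedEmbedding_eval_evalSymm (g := g) (M := M)).IsCompletelyMetrizableSpace
  infer_instance

theorem exists_deviation_of_dist_lt {β : FibreMaps g M}
    (h : ∀ s t, ‖(β.1 s).toHomeo t - g.toHomeo t‖ < 1 / 2) :
    ∃ φ : C(Torus, ℝ), IsDeviation g M β φ := by
  refine ⟨⟨fun p => smallLift ((β.1 p.1).toHomeo p.2 - g.toHomeo p.2),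
    continuous_smallLift_comp ((FibreMaps.eval β).continuous.sub
      (g.toHomeo.continuous.comp continuous_snd)) fun p => h p.1 p.2⟩, fun s hs t => ?_,
    fun s t => ?_⟩
  · simp [β.2 s hs, smallLift_zero]
  · simp [coe_smallLift]

end FibreMaps

/-! ### Increasing the rotation number -/

theorem translate_mul_apply (ε : ℝ) (G : CircleDeg1Lift) (x : ℝ) :
    ((CircleDeg1Lift.translate (Multiplicative.ofAdd ε) : CircleDeg1Lift) * G) x = ε + G x := by
  rw [CircleDeg1Lift.mul_apply, CircleDeg1Lift.translate_apply]

/-- The translation number is strictly increasing at a map with irrational translation number. -/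
theorem IsDenjoyLift.lt_translationNumber_translate_mul {g : HomeoPlus} {ρ : ℝ}
    {M : Set UnitAddCircle} {G H : CircleDeg1Lift} (h : IsDenjoyLift g ρ M G H) {ε : ℝ}
    (hε : 0 < ε) :
    ρ < ((CircleDeg1Lift.translate (Multiplicative.ofAdd ε) : CircleDeg1Lift) *
      G).translationNumber := by
  set G' : CircleDeg1Lift := (CircleDeg1Lift.translate (Multiplicative.ofAdd ε) : CircleDeg1Lift) * G
    with hG'
  obtain ⟨x, hx⟩ := growthSet_nonempty H
  -- At `y = x + ε / 2` this gives `G^q y < y + p`, with a gap below `ε`; the added translation then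
  -- gives `G'^q y > y + p`. So `p / q` separates the translation numbers, strictly from `ρ` by
  -- irrationality.
  obtain ⟨q, hq, p, hp⟩ := exists_iterate_sub_mem_Ioo h.irrational h.semiconj 1 (x + ε / 2)
    (hx (ε / 2) (by linarith))
  have hle : (G : ℝ → ℝ) ≤ G' := fun y => by
    rw [hG', translate_mul_apply]
    linarith
  have h1 : G^[q] (x + ε / 2) + ε ≤ G'^[q] (x + ε / 2) := by
    obtain ⟨q, rfl⟩ : ∃ r, q = r + 1 := ⟨q - 1, by omega⟩
    rw [Function.iterate_succ_apply', Function.iterate_succ_apply', hG', translate_mul_apply,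
      ← hG', add_comm]
    gcongr
    exact G.monotone.iterate_le_of_le hle q _
  have h2 := (G ^ q).translationNumber_le_of_le_add_int (x := x + ε / 2) (m := p) (by
    rw [CircleDeg1Lift.coe_pow]
    linarith [hp.2])
  have h3 := (G' ^ q).le_translationNumber_of_add_int_le (x := x + ε / 2) (m := p) (by
    rw [CircleDeg1Lift.coe_pow]
    linarith [hp.1])
  rw [CircleDeg1Lift.translationNumber_pow] at h2 h3
  rw [h.translationNumber_eq] at h2
  have hne : (q : ℝ) * ρ ≠ p := (h.irrational.natCast_mul (by omega)).ne_int p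
  have hlt : (q : ℝ) * ρ < q * G'.translationNumber := (lt_of_le_of_ne h2 hne).trans_le h3
  exact lt_of_mul_lt_mul_left hlt (Nat.cast_nonneg q)

/-- The orbit of `y` under the maps `x ↦ G x + φ k x + θ`. -/
def drift (G : ℝ → ℝ) (φ : ℕ → ℝ → ℝ) (y θ : ℝ) : ℕ → ℝ
  | 0 => y
  | k + 1 => G (drift G φ y θ k) + φ k (drift G φ y θ k) + θ

theorem continuous_drift {G : ℝ → ℝ} (hG : Continuous G) {φ : ℕ → ℝ → ℝ}
    (hφ : ∀ k, Continuous (φ k)) (y : ℝ) (n : ℕ) : Continuous fun θ => drift G φ y θ n := by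
  induction n with
  | zero => exact continuous_const
  | succ n ih => exact ((hG.comp ih).add ((hφ n).comp ih)).add continuous_id

/-- For `θ = ε` the orbit stays above that of `G + ε / 2`, for `θ = -ε` below that of `G`. Their
speeds differ, so after a time independent of `φ` and `y` the endpoints straddle some `y + p`, and
the intermediate value theorem in `θ` applies. -/
theorem IsDenjoyLift.exists_drift_eq {g : HomeoPlus} {ρ : ℝ} {M : Set UnitAddCircle}
    {G H : CircleDeg1Lift} (h : IsDenjoyLift g ρ M G H) {ε : ℝ} (hε : 0 < ε) :
    ∃ N : ℕ, ∀ n ≥ N, ∀ φ : ℕ → ℝ → ℝ, (∀ k, Continuous (φ k)) → (∀ k x, |φ k x| ≤ ε / 2) →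
      ∀ y : ℝ, ∃ θ ∈ Icc (-ε) ε, ∃ p : ℤ, drift G φ y θ n = y + p := by
  set G' : CircleDeg1Lift :=
    (CircleDeg1Lift.translate (Multiplicative.ofAdd (ε / 2)) : CircleDeg1Lift) * G with hG'
  have hlt : ρ < G'.translationNumber :=
    h.lt_translationNumber_translate_mul (show 0 < ε / 2 by linarith)
  -- Of the `3`, one unit is lost in each of the two orbit estimates and one in rounding up to an
  -- integer.
  obtain ⟨N, hN⟩ := exists_nat_gt (3 / (G'.translationNumber - ρ))
  refine ⟨N, fun n hn φ hφc hφ y => ?_⟩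
  have hup : ∀ k, G'^[k] y ≤ drift G φ y ε k := fun k => by
    induction k with
    | zero => exact le_rfl
    | succ k ih =>
      have h1 := (abs_le.1 (hφ k (drift G φ y ε k))).1
      have h2 := G.monotone ih
      rw [Function.iterate_succ_apply', hG', translate_mul_apply, ← hG', drift]
      linarith
  have hlow : ∀ k, drift G φ y (-ε) k ≤ G^[k] y := fun k => by
    induction k with
    | zero => exact le_rfl
    | succ k ih =>
      have h1 := (abs_le.1 (hφ k (drift G φ y (-ε) k))).2
      have h2 := G.monotone ih
      rw [Function.iterate_succ_apply', drift]
      linarith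
  have h1 : y + n * G'.translationNumber - 1 < G'^[n] y := by
    have h2 := (G' ^ n).translationNumber_le_ceil_sub y
    have h3 := Int.ceil_lt_add_one ((G' ^ n) y - y)
    rw [CircleDeg1Lift.translationNumber_pow] at h2
    rw [← CircleDeg1Lift.coe_pow]
    linarith
  have h2 : G^[n] y < y + n * ρ + 1 := by
    have h3 := (G ^ n).map_lt_add_translationNumber_add_one y
    rwa [CircleDeg1Lift.translationNumber_pow, h.translationNumber_eq,
      CircleDeg1Lift.coe_pow] at h3
  have h3 : 3 < n * (G'.translationNumber - ρ) := by
    rw [← div_lt_iff₀ (sub_pos.2 hlt)]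
    exact hN.trans_le (by exact_mod_cast hn)
  have h4 := Int.le_ceil (drift G φ y (-ε) n - y)
  have h5 := Int.ceil_lt_add_one (drift G φ y (-ε) n - y)
  have h6 := hup n
  have h7 := hlow n
  obtain ⟨θ, hθ, hθn⟩ := intermediate_value_Icc (show -ε ≤ ε by linarith)
    (continuous_drift h.isLift.1 hφc y n).continuousOn
    (show y + ⌈drift G φ y (-ε) n - y⌉ ∈ _ from ⟨by linarith, by linarith⟩)
  exact ⟨θ, hθ, _, hθn⟩

/-! ### Rotating the fibre maps -/

/-- The composition of `g` with the rotation by `θ`. -/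
noncomputable def HomeoPlus.rotate (θ : ℝ) (g : HomeoPlus) : HomeoPlus where
  toHomeo := g.toHomeo.trans (Homeomorph.addRight (θ : UnitAddCircle))
  exists_lift := by
    obtain ⟨G, hG⟩ := g.exists_lift
    refine ⟨(CircleDeg1Lift.translate (Multiplicative.ofAdd θ) : CircleDeg1Lift) * G, ?_,
      fun x => ?_⟩
    · exact (hG.1.const_add θ).congr fun x => (translate_mul_apply θ G x).symm
    · rw [translate_mul_apply, add_comm, AddCircle.coe_add, hG.2]
      rfl

theorem HomeoPlus.rotate_apply (θ : ℝ) (g : HomeoPlus) (t : UnitAddCircle) :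
    (g.rotate θ).toHomeo t = g.toHomeo t + (θ : UnitAddCircle) := rfl

/-- The fibre map `s ↦ R_{θ χ(s)} ∘ β(s)`, where `χ` vanishes on `M`. -/
noncomputable def FibreMaps.rotate {g : HomeoPlus} {M : Set UnitAddCircle} (β : FibreMaps g M)
    (θ : ℝ) (χ : C(UnitAddCircle, ℝ)) (hχ : EqOn χ 0 M) : FibreMaps g M :=
  ⟨⟨fun s => (β.1 s).rotate (θ * χ s), continuous_homeoPlus_of_uncurry
    ((FibreMaps.eval β).continuous.add (continuous_coe.comp (by fun_prop)))⟩, fun s hs => by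
      refine HomeoPlus.ext_toHomeo fun t => ?_
      change ((β.1 s).rotate (θ * χ s)).toHomeo t = _
      rw [HomeoPlus.rotate_apply, hχ hs, β.2 s hs]
      simp⟩

theorem FibreMaps.rotate_apply {g : HomeoPlus} {M : Set UnitAddCircle} (β : FibreMaps g M)
    (θ : ℝ) (χ : C(UnitAddCircle, ℝ)) (hχ : EqOn χ 0 M) (s t : UnitAddCircle) :
    ((FibreMaps.rotate β θ χ hχ).1 s).toHomeo t =
      (β.1 s).toHomeo t + ((θ * χ s : ℝ) : UnitAddCircle) := rfl

/-! ### Generic recurrence -/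

section

variable {g₁ g₂ : HomeoPlus} {ρ₁ ρ₂ : ℝ} {M₁ M₂ : Set UnitAddCircle}
  {G₁ H₁ G₂ H₂ : CircleDeg1Lift}

/-- The fibre maps `β` for which `f_β` has an orbit returning to `U`. -/
def returnSet (g₁ g₂ : HomeoPlus) (M₁ : Set UnitAddCircle) (U : Set Torus) :
    Set (FibreMaps g₂ M₁) :=
  {β | ∃ n : ℕ, 0 < n ∧ ∃ p ∈ U, (skew g₁ β.1)^[n] p ∈ U}

theorem continuous_skew_iterate (n : ℕ) (p : Torus) :
    Continuous fun β : FibreMaps g₂ M₁ => (skew g₁ β.1)^[n] p := by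
  induction n with
  | zero => exact continuous_const
  | succ n ih =>
    simp only [Function.iterate_succ_apply']
    exact (g₁.toHomeo.continuous.comp (continuous_fst.comp ih)).prodMk
      (continuous_homeoPlus_apply (continuous_subtype_val.eval (continuous_fst.comp ih))
        (continuous_snd.comp ih))

theorem isOpen_returnSet {U : Set Torus} (hU : IsOpen U) : IsOpen (returnSet g₁ g₂ M₁ U) := by
  have : returnSet g₁ g₂ M₁ U = ⋃ n : ℕ, ⋃ _ : 0 < n, ⋃ p ∈ U,
      {β | (skew g₁ β.1)^[n] p ∈ U} := by
    ext β
    simp [returnSet]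
  rw [this]
  exact isOpen_iUnion fun n => isOpen_iUnion fun _ => isOpen_iUnion fun p => isOpen_iUnion fun _ =>
    hU.preimage (continuous_skew_iterate n p)

open Classical in
-- The uniform bound on visits makes the set of visit times finite.
theorem IsDenjoyLift.eventually_notMem {g : HomeoPlus} {ρ : ℝ} {M : Set UnitAddCircle}
    {G H : CircleDeg1Lift} (h : IsDenjoyLift g ρ M G H) {C : Set UnitAddCircle} (hC : IsCompact C)
    (hCM : Disjoint C M) (s : UnitAddCircle) : ∃ K : ℕ, ∀ k ≥ K, g.toHomeo^[k] s ∉ C := by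
  obtain ⟨N, hN⟩ := h.exists_card_visits_le hC hCM
  have hfin : {k : ℕ | g.toHomeo^[k] s ∈ C}.Finite := by
    by_contra hinf
    obtain ⟨T, hTsub, hT⟩ := Set.Infinite.exists_subset_card_eq hinf (N + 1)
    obtain ⟨n, hn⟩ := T.exists_nat_subset_range
    have h1 : T ⊆ (Finset.range n).filter fun k => g.toHomeo^[k] s ∈ C := fun k hk =>
      Finset.mem_filter.2 ⟨hn hk, hTsub hk⟩
    have h2 := (Finset.card_le_card h1).trans (hN s n)
    omega
  obtain ⟨K, hK⟩ := hfin.bddAbove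
  exact ⟨K + 1, fun k hk hkC => by
    have := hK hkC
    omega⟩

theorem iterate_notMem {f : UnitAddCircle ≃ₜ UnitAddCircle} {M : Set UnitAddCircle}
    (hM : f '' M = M) {s : UnitAddCircle} (hs : s ∉ M) (n : ℕ) : f^[n] s ∉ M := by
  induction n with
  | zero => exact hs
  | succ n ih =>
    rw [Function.iterate_succ_apply', ← hM]
    rintro ⟨t, ht, hts⟩
    exact ih (f.injective hts ▸ ht)

theorem rotate_iterate (h₁ : IsCircleLift G₂ g₂.toHomeo) (β : FibreMaps g₂ M₁) {θ : ℝ}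
    {χ : C(UnitAddCircle, ℝ)} (hχ : EqOn χ 0 M₁) {s : UnitAddCircle} {n : ℕ}
    (hχs : ∀ k < n, χ (g₁.toHomeo^[k] s) = 1) {φ : ℕ → ℝ → ℝ}
    (hφ : ∀ k, ∀ x : ℝ, (β.1 (g₁.toHomeo^[k] s)).toHomeo x =
      g₂.toHomeo x + (φ k x : UnitAddCircle)) (y : ℝ) :
    ∀ k ≤ n, (skew g₁ (FibreMaps.rotate β θ χ hχ).1)^[k] (s, (y : UnitAddCircle)) =
      (g₁.toHomeo^[k] s, ((drift G₂ φ y θ k : ℝ) : UnitAddCircle)) := by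
  intro k hk
  induction k with
  | zero => rfl
  | succ k ih =>
    rw [Function.iterate_succ_apply', ih (by omega), skew_apply, FibreMaps.rotate_apply, hφ,
      hχs k (by omega), mul_one, drift, AddCircle.coe_add, AddCircle.coe_add, h₁.2,
      Function.iterate_succ_apply']

/-- A base orbit off `M₁` passes near `s` twice, `n` steps apart. Rotating the fibres over the piece
in between by a suitable `θ`, with `|θ| ≤ ε`, returns the fibre coordinate exactly to `y`. -/
theorem dense_returnSet (h₁ : IsDenjoyLift g₁ ρ₁ M₁ G₁ H₁) (h₂ : IsDenjoyLift g₂ ρ₂ M₂ G₂ H₂)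
    (hM : IsClosed M₁) (hMg : g₁.toHomeo '' M₁ = M₁) (hne : M₁ ≠ univ) {U : Set Torus}
    (hU : IsOpen U) (hUM : (U ∩ M₁ ×ˢ univ).Nonempty) : Dense (returnSet g₁ g₂ M₁ U) := by
  intro β₀
  refine mem_closure_iff_nhds.2 fun W hW => ?_
  obtain ⟨ε, hε, hWε⟩ := exists_forall_mem_of_mem_nhds hW
  obtain ⟨⟨s, t⟩, hst, hs, -⟩ := hUM
  obtain ⟨y, rfl⟩ := coe_surjective t
  have hJ : (fun s' : UnitAddCircle => (s', (y : UnitAddCircle))) ⁻¹' U ∈ 𝓝 s :=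
    (hU.preimage (by fun_prop)).mem_nhds hst
  -- The orbit must avoid `M₁`, where the fibre maps cannot be changed.
  obtain ⟨r, hr⟩ := (ne_univ_iff_exists_notMem M₁).1 hne
  -- `ε / 2` is the perturbation allowed in `IsDenjoyLift.exists_drift_eq`; `1 / 4` keeps
  -- `smallLift` away from its discontinuity.
  have hδ : 0 < min (ε / 2) (1 / 4) := lt_min (by linarith) (by norm_num)
  set δ := min (ε / 2) (1 / 4) with hδdef
  have hcont : Continuous fun p : Torus => (β₀.1 p.1).toHomeo p.2 - g₂.toHomeo p.2 :=
    (FibreMaps.eval β₀).continuous.sub (g₂.toHomeo.continuous.comp continuous_snd)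
  set C : Set UnitAddCircle :=
    Prod.fst '' {p : Torus | δ ≤ ‖(β₀.1 p.1).toHomeo p.2 - g₂.toHomeo p.2‖} with hC
  have hCc : IsCompact C :=
    (isClosed_le continuous_const hcont.norm).isCompact.image continuous_fst
  have hCM : Disjoint C M₁ := by
    rw [disjoint_left]
    rintro _ ⟨⟨a, b⟩, hab, rfl⟩ ha
    have h0 : δ ≤ ‖(β₀.1 a).toHomeo b - g₂.toHomeo b‖ := hab
    rw [β₀.2 a ha, sub_self, norm_zero] at h0
    linarith
  obtain ⟨K, hK⟩ := h₁.eventually_notMem hCc hCM r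
  obtain ⟨N, hN⟩ := h₂.exists_drift_eq hε
  -- Starting after time `K`, the orbit never meets `C` again, so its fibre maps stay `δ`-close to
  -- `g₂`.
  obtain ⟨k₀, hk₀, hk₀J⟩ := h₁.exists_iterate_mem K r hs hJ
  set s₀ := g₁.toHomeo^[k₀] r with hs₀
  obtain ⟨n, hn, hnJ⟩ := h₁.exists_iterate_mem (N + 1) s₀ hs hJ
  have hsmall : ∀ (k : ℕ) (t : UnitAddCircle),
      ‖(β₀.1 (g₁.toHomeo^[k] s₀)).toHomeo t - g₂.toHomeo t‖ < δ := fun k t => by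
    by_contra hge
    refine hK (k + k₀) (by omega) ⟨(g₁.toHomeo^[k] s₀, t), not_lt.1 hge, ?_⟩
    rw [Function.iterate_add_apply]
  let φ : ℕ → ℝ → ℝ := fun k x =>
    smallLift ((β₀.1 (g₁.toHomeo^[k] s₀)).toHomeo x - g₂.toHomeo x)
  have hδ1 : δ ≤ ε / 2 := min_le_left _ _
  have hδ2 : δ ≤ 1 / 4 := min_le_right _ _
  obtain ⟨θ, hθ, p, hp⟩ := hN n (by omega) φ
    (fun k => (continuous_smallLift_comp ((Homeomorph.continuous _).sub g₂.toHomeo.continuous)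
      fun t => (hsmall k t).trans_le (by linarith)).comp continuous_coe)
    (fun k x => by
      rw [abs_smallLift]
      linarith [hsmall k x]) y
  set T : Set UnitAddCircle := (fun k => g₁.toHomeo^[k] s₀) '' Iio n with hT
  have hTc : IsClosed T := ((finite_Iio n).image _).isClosed
  have hs₀M : s₀ ∉ M₁ := iterate_notMem hMg hr k₀
  have hTM : Disjoint M₁ T := by
    rw [disjoint_right]
    rintro _ ⟨k, -, rfl⟩
    exact iterate_notMem hMg hs₀M k
  -- Urysohn: the rotation acts fully along the finite orbit piece `T` and vanishes on `M₁`.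
  obtain ⟨χ, hχ0, hχ1, hχ⟩ := exists_continuous_zero_one_of_isClosed hM hTc hTM
  refine ⟨FibreMaps.rotate β₀ θ χ hχ0, hWε _ fun q => ?_, n, by omega, (s₀, (y : UnitAddCircle)),
    hk₀J, ?_⟩
  · rw [FibreMaps.eval_apply, FibreMaps.rotate_apply, FibreMaps.eval_apply, dist_eq_norm,
      add_sub_cancel_left]
    refine (norm_coe_le_abs _).trans ?_
    rw [abs_mul, abs_of_nonneg (hχ q.1).1]
    exact (mul_le_of_le_one_right (abs_nonneg _) (hχ q.1).2).trans (abs_le.2 hθ)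
  · rw [rotate_iterate h₂.isLift β₀ hχ0 (fun k hk => hχ1 ⟨k, hk, rfl⟩) (φ := φ)
      (fun k x => by simp [φ, coe_smallLift]) y n le_rfl, hp, coe_add_int]
    exact hnJ

/-! ### The nonwandering set, and failure of transitivity on it -/

theorem nonwanderingSet_skew_subset (h₁ : IsDenjoyLift g₁ ρ₁ M₁ G₁ H₁) (β : FibreMaps g₂ M₁) :
    nonwanderingSet (skew g₁ β.1) ⊆ M₁ ×ˢ univ := by
  rintro ⟨s, t⟩ hst
  refine ⟨?_, mem_univ _⟩
  by_contra hs
  obtain ⟨U, hUo, hsU, hU⟩ := h₁.exists_wandering_nhds hs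
  obtain ⟨n, hn, _, ⟨p, hp, rfl⟩, hq⟩ :=
    hst (U ×ˢ univ) ((hUo.prod isOpen_univ).mem_nhds ⟨hsU, mem_univ _⟩)
  refine hU n hn p.1 hp.1 ?_
  rw [← skew_iterate_fst g₁ β.1]
  exact hq.1

theorem not_isTransitiveOn_skew (h₂ : IsDenjoyLift g₂ ρ₂ M₂ G₂ H₂) (hM : M₁.Nonempty)
    (hMg : g₁.toHomeo '' M₁ = M₁) (hne : M₂ ≠ univ) (β : FibreMaps g₂ M₁) :
    ¬ IsTransitiveOn (skew g₁ β.1) (M₁ ×ˢ univ) := by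
  intro htrans
  obtain ⟨t, ht⟩ := (ne_univ_iff_exists_notMem M₂).1 hne
  -- Over `M₁` the fibre coordinate moves by `g₂`, so the strip over a wandering `V` never returns
  -- to itself.
  obtain ⟨V, hVo, htV, hV⟩ := h₂.exists_wandering_nhds ht
  obtain ⟨s, hs⟩ := hM
  have hmem : (univ ×ˢ V ∩ M₁ ×ˢ univ : Set Torus).Nonempty :=
    ⟨(s, t), ⟨mem_univ _, htV⟩, hs, mem_univ _⟩
  obtain ⟨n, hn, _, ⟨⟨a, b⟩, hp, rfl⟩, hq⟩ :=
    htrans _ _ (isOpen_univ.prod hVo) (isOpen_univ.prod hVo) hmem hmem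
  refine hV n hn b hp.1.2 ?_
  rw [skew_iterate_of_mem hMg β hp.2.1] at hq
  exact hq.1.2

theorem exists_generic_nonwanderingSet_eq (h₁ : IsDenjoyLift g₁ ρ₁ M₁ G₁ H₁)
    (h₂ : IsDenjoyLift g₂ ρ₂ M₂ G₂ H₂) (hM : IsClosed M₁) (hMg : g₁.toHomeo '' M₁ = M₁)
    (hne : M₁ ≠ univ) : ∃ R : Set (FibreMaps g₂ M₁), IsGδ R ∧ Dense R ∧
      ∀ β ∈ R, nonwanderingSet (skew g₁ β.1) = M₁ ×ˢ univ := by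
  set I : Set (Set Torus) :=
    {U ∈ TopologicalSpace.countableBasis Torus | (U ∩ M₁ ×ˢ univ).Nonempty} with hI
  have hIc : I.Countable := (TopologicalSpace.countable_countableBasis Torus).mono (sep_subset _ _)
  have hIo : ∀ U ∈ I, IsOpen U := fun U hU => TopologicalSpace.isOpen_of_mem_countableBasis hU.1
  refine ⟨⋂ U ∈ I, returnSet g₁ g₂ M₁ U, ?_, ?_, fun β hβ => ?_⟩
  · exact IsGδ.biInter_of_isOpen hIc fun U hU => isOpen_returnSet (hIo U hU)
  · exact dense_biInter_of_isOpen (fun U hU => isOpen_returnSet (hIo U hU)) hIc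
      fun U hU => dense_returnSet h₁ h₂ hM hMg hne (hIo U hU) hU.2
  · refine (nonwanderingSet_skew_subset h₁ β).antisymm fun x hx V hV => ?_
    obtain ⟨U, hU, hxU, hUV⟩ :=
      (TopologicalSpace.isBasis_countableBasis Torus).mem_nhds_iff.1 hV
    obtain ⟨n, hn, p, hp, hpn⟩ := mem_iInter₂.1 hβ U ⟨hU, x, hxU, hx⟩
    exact ⟨n, hn, _, mem_image_of_mem _ (hUV hp), hUV hpn⟩

/-- A dense set meets the ball of radius `1/2` about the constant map, where the deviation exists
directly through `smallLift`; no homotopy is needed for the final example. -/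
theorem exists_mem_deviation {g : HomeoPlus} {M : Set UnitAddCircle} {R : Set (FibreMaps g M)}
    (hR : Dense R) : ∃ β ∈ R, ∃ φ : C(Torus, ℝ), IsDeviation g M β φ := by
  let β₀ : FibreMaps g M := ⟨ContinuousMap.const _ g, fun _ _ => rfl⟩
  obtain ⟨β, hβ, hβR⟩ := hR.inter_open_nonempty _
    ((Metric.isOpen_ball (x := FibreMaps.eval β₀) (ε := 1 / 2)).preimage isInducing_eval.continuous)
    ⟨β₀, Metric.mem_ball_self (by norm_num)⟩
  refine ⟨β, hβR, exists_deviation_of_dist_lt fun s t => ?_⟩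
  have h := (ContinuousMap.dist_apply_le_dist (f := FibreMaps.eval β) (g := FibreMaps.eval β₀)
    (s, t)).trans_lt hβ
  rwa [dist_eq_norm] at h

end

end DenjoySkew

theorem mainTheorem6
    (g₁ g₂ : DenjoySkew.HomeoPlus) (ρ₁ ρ₂ : ℝ) (M₁ M₂ : Set UnitAddCircle)
    (h₁ : DenjoySkew.IsDenjoyCounterexample g₁ ρ₁ M₁)
    (h₂ : DenjoySkew.IsDenjoyCounterexample g₂ ρ₂ M₂)
    (hρ : LinearIndependent ℚ ![(1 : ℝ), ρ₁, ρ₂]) :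
    -- every `f_β` has `M₁ × M₂` as its unique minimal set
    (∀ β : DenjoySkew.FibreMaps g₂ M₁, ∀ K : Set DenjoySkew.Torus,
      DenjoySkew.IsMinimalSet (DenjoySkew.skew g₁ β.1) K ↔ K = M₁ ×ˢ M₂) ∧
    -- if `β` is homotopic in `𝓑` to the constant map `g₂`, then `f_β` is non-resonant, with
    -- rotation vector `(ρ₁, ρ₂)`
    (∀ β : DenjoySkew.FibreMaps g₂ M₁,
      ContinuousMap.HomotopicRel β.1 (ContinuousMap.const UnitAddCircle g₂) M₁ →
        DenjoySkew.IsNonResonant (DenjoySkew.skew g₁ β.1) ∧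
        DenjoySkew.HasUniqueRotationVector (DenjoySkew.skew g₁ β.1) (ρ₁, ρ₂)) ∧
    -- for a dense `G_δ` set of `β`, the nonwandering set is `M₁ × S¹` and is not transitive
    (∃ R : Set (DenjoySkew.FibreMaps g₂ M₁), IsGδ R ∧ Dense R ∧ ∀ β ∈ R,
      DenjoySkew.nonwanderingSet (DenjoySkew.skew g₁ β.1) = M₁ ×ˢ (Set.univ : Set UnitAddCircle) ∧
      ¬ DenjoySkew.IsTransitiveOn (DenjoySkew.skew g₁ β.1)
        (DenjoySkew.nonwanderingSet (DenjoySkew.skew g₁ β.1))) ∧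
    -- in particular there is a non-resonant example with these properties
    (∃ β : DenjoySkew.FibreMaps g₂ M₁,
      DenjoySkew.IsNonResonant (DenjoySkew.skew g₁ β.1) ∧
      DenjoySkew.nonwanderingSet (DenjoySkew.skew g₁ β.1) = M₁ ×ˢ (Set.univ : Set UnitAddCircle) ∧
      ¬ DenjoySkew.IsTransitiveOn (DenjoySkew.skew g₁ β.1)
        (DenjoySkew.nonwanderingSet (DenjoySkew.skew g₁ β.1))) := by
  obtain ⟨G₁, H₁, hl₁⟩ := h₁.exists_lift
  obtain ⟨G₂, H₂, hl₂⟩ := h₂.exists_lift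
  have hM₁ := h₁.isMinimalSet
  obtain ⟨R, hRδ, hRd, hR⟩ := DenjoySkew.exists_generic_nonwanderingSet_eq hl₁ hl₂
    hM₁.isCompact.isClosed hM₁.invariant h₁.ne_univ
  have hRt : ∀ β ∈ R, ¬ DenjoySkew.IsTransitiveOn (DenjoySkew.skew g₁ β.1)
      (DenjoySkew.nonwanderingSet (DenjoySkew.skew g₁ β.1)) := fun β hβ => by
    rw [hR β hβ]
    exact DenjoySkew.not_isTransitiveOn_skew hl₂ hM₁.nonempty hM₁.invariant h₂.ne_univ β
  refine ⟨DenjoySkew.isMinimalSet_skew_iff h₁ h₂ hρ, fun β hβ => ?_,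
    ⟨R, hRδ, hRd, fun β hβ => ⟨hR β hβ, hRt β hβ⟩⟩, ?_⟩
  · obtain ⟨φ, hφ⟩ := DenjoySkew.exists_deviation_of_homotopicRel hβ
    exact ⟨DenjoySkew.isNonResonant_skew hl₁ hl₂ hρ hφ,
      DenjoySkew.hasUniqueRotationVector_skew hl₁ hl₂ hφ⟩
  · obtain ⟨β, hβ, φ, hφ⟩ := DenjoySkew.exists_mem_deviation hRd
    exact ⟨β, DenjoySkew.isNonResonant_skew hl₁ hl₂ hρ hφ, hR β hβ, hRt β hβ⟩
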